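/- Let $a,b,\sigma\in\mathbb R$ be non-zero constants, $d\in\mathbb R$, and let $\Theta=(\alpha,\beta)$ with $0<\alpha<\beta<\infty$. For $\vartheta\in\Theta$ let $\mathbf P_{\vartheta}$ (with expectation $\mathbf E_\vartheta$) be the law under which $$dX_t=aY_t\,dt+\sigma\,dW_t,\quad X_0=0,\qquad\qquad dY_t=-\vartheta Y_t\,dt+b\,dV_t,\quad Y_0=\xi,\qquad t\ge 0,$$ where $W$ and $V$ are independent standard Wiener processes and $\xi\sim\mathcal N(0,d^2)$ is independent of $(W,V)$; only $X$ is observed, and $\vartheta$ is the unknown parameter. For an integer $K\ge1$ put $$\mathbb S_K=\frac1K\sum_{k=1}^{K}(X_k-X_{k-1})^2,\qquad \Phi(\vartheta)=\frac{a^2b^2}{\vartheta^3}\left(e^{-\vartheta}-1+\vartheta\right)+\sigma^2 .$$ Then $\Phi$ is strictly decreasing on $[\alpha,\beta]$, and for every $s\in(\Phi(\beta),\Phi(\alpha))$ the equation $\Phi(\vartheta)=s$ has exactly one root in $(\alpha,\beta)$. Define the estimator $\bar\vartheta_K$ by $\bar\vartheta_K=\alpha$ if $\mathbb S_K\ge\Phi(\alpha)$,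 $\bar\vartheta_K=\beta$ if $\mathbb S_K\le\Phi(\beta)$, and otherwise let $\bar\vartheta_K\in(\alpha,\beta)$ be the root of $\Phi(\bar\vartheta_K)=\mathbb S_K$. (i) $\bar\vartheta_K$ is consistent, uniformly on compacts: for every $[\bar\alpha,\bar\beta]\subset\Theta$ and every $\varepsilon>0$, $$\lim_{K\to\infty}\ \sup_{\vartheta_0\in[\bar\alpha,\bar\beta]}\mathbf P_{\vartheta_0}\left(|\bar\vartheta_K-\vartheta_0|>\varepsilon\right)=0 .$$ (ii) There is a constant $C>0$, depending only on $a,b,\sigma,d,\alpha,\beta$, such that for all integers $K\ge 1$ $$\sup_{\vartheta_0\in\Theta}\mathbf E_{\vartheta_0}\left|\bar\vartheta_K-\vartheta_0\right|^2\le\frac CK ,$$ and such that, for all $\delta\in(1/2,1)$ and all real $T\ge1$, with $K=\lfloor T^\delta\rfloor$, $$\sup_{\vartheta_0\in\Theta}\mathbf E_{\vartheta_0}\left|\bar\vartheta_{K}-\vartheta_0\right|^2\le C\,T^{-\delta}.$$ -/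

import Mathlib

open MeasureTheory ProbabilityTheory
open scoped NNReal

universe u

namespace HiddenOU

/-- The processes `W, V, X, Y` (indexed by `t ≥ 0`) and the random variable `ξ` on `(Ω, P)` solve
the partially observed linear system
`dX_t = a Y_t dt + σ dW_t`, `X_0 = 0`, and `dY_t = -θ Y_t dt + b dV_t`, `Y_0 = ξ`,
where `W` and `V` are independent Wiener processes and `ξ ∼ N(0, d²)` is independent of `(W, V)`.
As the noise is additive, the equations are read pathwise, in integrated form. -/
structure IsModel {Ω : Type u} [MeasurableSpace Ω] (P : Measure Ω) (a b σ d θ : ℝ)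
    (W V : ℝ≥0 → Ω → ℝ) (ξ : Ω → ℝ) (X Y : ℝ≥0 → Ω → ℝ) : Prop where
  wiener_W : IsBrownianReal W P
  wiener_V : IsBrownianReal V P
  law_init : HasLaw ξ (gaussianReal 0 (d ^ 2).toNNReal) P
  indep_noises : IndepFun (fun ω t => W t ω) (fun ω t => V t ω) P
  indep_init : IndepFun ξ (fun ω => ((fun t => W t ω), (fun t => V t ω))) P
  continuous_Y : ∀ᵐ ω ∂P, Continuous (fun t => Y t ω)
  eq_Y : ∀ᵐ ω ∂P, ∀ t : ℝ≥0,
    Y t ω = ξ ω - θ * (∫ s in (0 : ℝ)..t, Y s.toNNReal ω) + b * V t ω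
  eq_X : ∀ᵐ ω ∂P, ∀ t : ℝ≥0,
    X t ω = a * (∫ s in (0 : ℝ)..t, Y s.toNNReal ω) + σ * W t ω

/-- The statistic `S_K = K⁻¹ ∑_{k=1}^K (X_k - X_{k-1})²` (the sum is written with `k - 1` for
`k`). -/
noncomputable def S {Ω : Type u} (X : ℝ≥0 → Ω → ℝ) (K : ℕ) (ω : Ω) : ℝ :=
  (1 / (K : ℝ)) * ∑ k ∈ Finset.range K, (X ((k : ℝ≥0) + 1) ω - X (k : ℝ≥0) ω) ^ 2

/-- The function `Φ(θ) = a² b² θ⁻³ (e^{-θ} - 1 + θ) + σ²`. -/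
noncomputable def Phi (a b σ θ : ℝ) : ℝ :=
  a ^ 2 * b ^ 2 / θ ^ 3 * (Real.exp (-θ) - 1 + θ) + σ ^ 2

open Classical in
/-- The preliminary estimate as a function of the value `s` of the statistic: `α` if
`s ≥ Φ(α)`, `β` if `s ≤ Φ(β)`, and otherwise the root in `(α, β)` of the equation
`Φ(θ) = s`. -/
noncomputable def invert (a b σ α β s : ℝ) : ℝ :=
  if Phi a b σ α ≤ s then α
  else if s ≤ Phi a b σ β then β
  else Function.invFunOn (Phi a b σ) (Set.Ioo α β) s

/-- The preliminary estimator based on the observations up to time `K`. -/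
noncomputable def estimator {Ω : Type u} (a b σ α β : ℝ) (X : ℝ≥0 → Ω → ℝ) (K : ℕ) (ω : Ω) : ℝ :=
  invert a b σ α β (S X K ω)

end HiddenOU

/-! Observed at integer times, the system is an autoregression seen in noise. Variation of constants
gives `Y_{n+1} = ρ Y_n + η_n` and `X_{n+1} - X_n = κ Y_n + ε_n` with `ρ = e^{-θ}` and `κ = a(1 -
e^{-θ})/θ`. The pairs `(η_n, ε_n)` are centred, independent of the past, and have second moments
that do not depend on `n`. Integration by parts replaces every stochastic integral by a pathwise
integral of `V` (`linear_equation_step`), so Fubini and the covariance `min s t` suffice to compute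
`q = E η²` and `r = E ε²`.

Put `l = κ²/(1 - ρ²)`. Adding `l Y_n²` to the sum of `(κ Y_k + ε_k)² - (l q + r)` cancels the terms
in `Y_k²`, so the sum is a martingale plus the boundary term `l (Y_0² - Y_n²)` (`mart_succ`). The
martingale increments are orthogonal to the past and bounded in `L²` through fourth moments that are
uniform in `n` and `θ`. Hence the sum over `K` steps has mean square `O(K)`. Since `l q + r = Φ(θ)`
(`Phi_eq_stationary`), this says `E (S_K - Φ(θ))² = O(1/K)`.

On `[α, β]` the function `Φ` decreases with slope bounded away from zero (`slope_mul_le_Phi_sub`),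
and the estimator inverts `Φ` after clipping `S_K` to its range. Its error is therefore at most a
constant times `|S_K - Φ(θ)|` (`slope_mul_abs_invert_sub_le`). This yields the mean-square rate, and
Chebyshev's inequality yields uniform consistency. -/

namespace HiddenOU

/-! ### Monotonicity of `Φ` and its clipped inverse -/

lemma two_sub_le_two_add_mul_exp_neg {x : ℝ} (hx : 0 ≤ x) :
    2 - x ≤ (2 + x) * Real.exp (-x) := by
  have hmono : MonotoneOn (fun x : ℝ => (2 + x) * Real.exp (-x) + x) (Set.Ici 0) := by
    apply monotoneOn_of_deriv_nonneg (convex_Ici 0)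
    · fun_prop
    · fun_prop
    · intro y _
      have h : HasDerivAt (fun x : ℝ => (2 + x) * Real.exp (-x) + x)
          (1 * Real.exp (-y) + (2 + y) * (Real.exp (-y) * -1) + 1) y :=
        ((((hasDerivAt_id y).const_add 2).mul ((hasDerivAt_neg y).exp)).add (hasDerivAt_id y))
      rw [h.deriv]
      have h1 : (y + 1) * Real.exp (-y) ≤ 1 := by
        calc (y + 1) * Real.exp (-y) ≤ Real.exp y * Real.exp (-y) := by
              gcongr; exact Real.add_one_le_exp y
          _ = 1 := by rw [← Real.exp_add]; simp
      linarith
  have := hmono (Set.mem_Ici.2 le_rfl) (Set.mem_Ici.2 hx) hx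
  simp at this
  linarith

lemma exp_neg_sub_one_add_pos {x : ℝ} (hx : 0 < x) : 0 < Real.exp (-x) - 1 + x := by
  have := Real.add_one_lt_exp (x := -x) (by linarith)
  linarith

/-- The numerator of the derivative is `x (2 - x - (2 + x) e^{-x})`, whose sign is given by
`two_sub_le_two_add_mul_exp_neg`. -/
lemma antitoneOn_exp_neg_sub_one_add_div_sq :
    AntitoneOn (fun x : ℝ => (Real.exp (-x) - 1 + x) / x ^ 2) (Set.Ioi 0) := by
  apply antitoneOn_of_deriv_nonpos (convex_Ioi 0)
  · apply ContinuousOn.div (by fun_prop) (by fun_prop)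
    intro x hx
    exact pow_ne_zero _ (ne_of_gt hx)
  · rw [interior_Ioi]
    intro x hx
    have : x ^ 2 ≠ 0 := pow_ne_zero _ (ne_of_gt hx)
    exact DifferentiableAt.differentiableWithinAt (by fun_prop (disch := assumption))
  · rw [interior_Ioi]
    intro x hx
    have hx0 : (0 : ℝ) < x := hx
    have h : HasDerivAt (fun x : ℝ => (Real.exp (-x) - 1 + x) / x ^ 2)
        (((Real.exp (-x) * -1 + 1) * x ^ 2 - (Real.exp (-x) - 1 + x) * (2 * x)) / (x ^ 2) ^ 2)
        x := by
      refine HasDerivAt.div ((((hasDerivAt_neg x).exp).sub_const 1).add (hasDerivAt_id x)) ?_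
        (pow_ne_zero _ hx0.ne')
      simpa using hasDerivAt_pow 2 x
    rw [h.deriv]
    apply div_nonpos_of_nonpos_of_nonneg _ (by positivity)
    have := two_sub_le_two_add_mul_exp_neg hx0.le
    nlinarith

/-- A lower bound for the slope of `Φ` on `[α, β]`. -/
noncomputable def slope (a b β : ℝ) : ℝ :=
  a ^ 2 * b ^ 2 * ((Real.exp (-β) - 1 + β) / β ^ 2) / β ^ 2

lemma slope_pos {a b β : ℝ} (ha : a ≠ 0) (hb : b ≠ 0) (hβ : 0 < β) : 0 < slope a b β := by
  have := exp_neg_sub_one_add_pos hβ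
  unfold slope
  positivity

lemma Phi_eq (a b σ : ℝ) {x : ℝ} (hx : x ≠ 0) :
    Phi a b σ x = a ^ 2 * b ^ 2 * ((Real.exp (-x) - 1 + x) / x ^ 2) / x + σ ^ 2 := by
  unfold Phi
  field_simp

/-- With `g(x) = (e^{-x} - 1 + x)/x²`, one has `Φ - σ² = a² b² g(x)/x`. As `g` decreases, `g(x)/x -
g(y)/y ≥ g(y)(1/x - 1/y) ≥ g(β)(y - x)/β²`. -/
lemma slope_mul_le_Phi_sub {a b σ α β x y : ℝ} (hα : 0 < α) (hx : x ∈ Set.Icc α β)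
    (hy : y ∈ Set.Icc α β) (hxy : x ≤ y) :
    slope a b β * (y - x) ≤ Phi a b σ x - Phi a b σ y := by
  have hx0 : 0 < x := hα.trans_le hx.1
  have hy0 : 0 < y := hα.trans_le hy.1
  have hβ0 : 0 < β := hx0.trans_le hx.2
  rw [Phi_eq a b σ hx0.ne', Phi_eq a b σ hy0.ne']
  have hA := antitoneOn_exp_neg_sub_one_add_div_sq
  have h1 := hA hx0 hy0 hxy
  have h2 := hA hy0 hβ0 hy.2
  simp only at h1 h2
  unfold slope
  set g := fun x : ℝ => (Real.exp (-x) - 1 + x) / x ^ 2 with hg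
  change g y ≤ g x at h1
  change g β ≤ g y at h2
  change a ^ 2 * b ^ 2 * g β / β ^ 2 * (y - x) ≤
    a ^ 2 * b ^ 2 * g x / x + σ ^ 2 - (a ^ 2 * b ^ 2 * g y / y + σ ^ 2)
  have hgβ : 0 ≤ g β := div_nonneg (exp_neg_sub_one_add_pos hβ0).le (by positivity)
  have hxy' : x * y ≤ β ^ 2 := by
    rw [sq]; exact mul_le_mul hx.2 hy.2 hy0.le hβ0.le
  calc a ^ 2 * b ^ 2 * g β / β ^ 2 * (y - x)
      ≤ a ^ 2 * b ^ 2 * g y / (x * y) * (y - x) := by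
        have : 0 ≤ y - x := by linarith
        have : 0 ≤ g y := hgβ.trans h2
        gcongr
    _ = a ^ 2 * b ^ 2 * g y / x - a ^ 2 * b ^ 2 * g y / y := by field_simp
    _ ≤ a ^ 2 * b ^ 2 * g x / x - a ^ 2 * b ^ 2 * g y / y := by gcongr
    _ = _ := by ring

lemma slope_mul_abs_sub_le {a b σ α β x y : ℝ} (hα : 0 < α) (hx : x ∈ Set.Icc α β)
    (hy : y ∈ Set.Icc α β) :
    slope a b β * |x - y| ≤ |Phi a b σ x - Phi a b σ y| := by
  rcases le_total x y with h | h
  · rw [abs_sub_comm, abs_of_nonneg (sub_nonneg.2 h)]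
    exact (slope_mul_le_Phi_sub hα hx hy h).trans (le_abs_self _)
  · rw [abs_of_nonneg (sub_nonneg.2 h), abs_sub_comm]
    exact (slope_mul_le_Phi_sub hα hy hx h).trans (le_abs_self _)

lemma strictAntiOn_Phi {a b σ α β : ℝ} (ha : a ≠ 0) (hb : b ≠ 0) (hα : 0 < α) (hαβ : α < β) :
    StrictAntiOn (Phi a b σ) (Set.Icc α β) := by
  intro x hx y hy hxy
  have h := slope_mul_le_Phi_sub (a := a) (b := b) (σ := σ) hα hx hy hxy.le
  have := mul_pos (slope_pos ha hb (hα.trans hαβ)) (sub_pos.2 hxy)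
  linarith

lemma continuousOn_Phi {a b σ α β : ℝ} (hα : 0 < α) :
    ContinuousOn (Phi a b σ) (Set.Icc α β) := by
  unfold Phi
  refine ContinuousOn.add (ContinuousOn.mul (ContinuousOn.div (by fun_prop) (by fun_prop) ?_)
    (by fun_prop)) (by fun_prop)
  intro x hx
  exact pow_ne_zero _ (hα.trans_le hx.1).ne'

lemma exists_Phi_eq {a b σ α β s : ℝ} (hα : 0 < α) (hαβ : α < β)
    (h1 : Phi a b σ β < s) (h2 : s < Phi a b σ α) :
    ∃ θ ∈ Set.Ioo α β, Phi a b σ θ = s := by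
  obtain ⟨θ, hθ, h⟩ := intermediate_value_Icc' hαβ.le (continuousOn_Phi (a := a) (b := b)
    (σ := σ) hα) ⟨h1.le, h2.le⟩
  refine ⟨θ, ⟨lt_of_le_of_ne hθ.1 ?_, lt_of_le_of_ne hθ.2 ?_⟩, h⟩
  · rintro rfl; exact h2.ne h.symm
  · rintro rfl; exact h1.ne h

/-- All three branches amount to clipping `s` to the range of `Φ`; this description is all that is
used about the estimator afterwards. -/
lemma invert_spec {a b σ α β : ℝ} (ha : a ≠ 0) (hb : b ≠ 0) (hα : 0 < α) (hαβ : α < β) (s : ℝ) :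
    invert a b σ α β s ∈ Set.Icc α β ∧
      Phi a b σ (invert a b σ α β s) = max (Phi a b σ β) (min s (Phi a b σ α)) := by
  have hlt : Phi a b σ β < Phi a b σ α := strictAntiOn_Phi ha hb hα hαβ
    (Set.left_mem_Icc.2 hαβ.le) (Set.right_mem_Icc.2 hαβ.le) hαβ
  unfold invert
  split_ifs with h1 h2
  · exact ⟨Set.left_mem_Icc.2 hαβ.le, by rw [min_eq_right h1, max_eq_right hlt.le]⟩
  · exact ⟨Set.right_mem_Icc.2 hαβ.le,
      by rw [min_eq_left (h2.trans hlt.le), max_eq_left h2]⟩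
  · push Not at h1 h2
    have hex := exists_Phi_eq hα hαβ h2 h1
    exact ⟨Set.Ioo_subset_Icc_self (Function.invFunOn_mem hex),
      by rw [Function.invFunOn_eq hex, min_eq_left h1.le, max_eq_right h2.le]⟩

/-- The root is produced by choice, so measurability has to come from monotonicity. -/
lemma measurable_invert {a b σ α β : ℝ} (ha : a ≠ 0) (hb : b ≠ 0) (hα : 0 < α) (hαβ : α < β) :
    Measurable (invert a b σ α β) := by
  apply Antitone.measurable
  intro s s' hs
  obtain ⟨h1, h2⟩ := invert_spec (σ := σ) ha hb hα hαβ s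
  obtain ⟨h1', h2'⟩ := invert_spec (σ := σ) ha hb hα hαβ s'
  by_contra! hlt
  have h3 := strictAntiOn_Phi (σ := σ) ha hb hα hαβ h1 h1' hlt
  rw [h2, h2'] at h3
  exact h3.not_ge (max_le_max le_rfl (min_le_min hs le_rfl))

/-- Clipping is 1-Lipschitz and fixes `Φ(θ)`. -/
lemma slope_mul_abs_invert_sub_le {a b σ α β θ : ℝ} (ha : a ≠ 0) (hb : b ≠ 0) (hα : 0 < α)
    (hαβ : α < β) (hθ : θ ∈ Set.Icc α β) (s : ℝ) :
    slope a b β * |invert a b σ α β s - θ| ≤ |s - Phi a b σ θ| := by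
  obtain ⟨h1, h2⟩ := invert_spec (σ := σ) ha hb hα hαβ s
  refine (slope_mul_abs_sub_le (σ := σ) hα h1 hθ).trans ?_
  have hanti := (strictAntiOn_Phi (σ := σ) ha hb hα hαβ).antitoneOn
  have h3 : Phi a b σ θ = max (Phi a b σ β) (min (Phi a b σ θ) (Phi a b σ α)) := by
    rw [min_eq_left (hanti (Set.left_mem_Icc.2 hαβ.le) hθ hθ.1),
      max_eq_right (hanti hθ (Set.right_mem_Icc.2 hαβ.le) hθ.2)]
  rw [h2]
  nth_rw 1 [h3]
  rw [max_comm, max_comm (Phi a b σ β)]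
  exact (abs_max_sub_max_le_abs _ _ _).trans (by simpa using abs_min_sub_min_le_max s (Phi a b σ α) (Phi a b σ θ) (Phi a b σ α))


/-! ### Mean square of the centred sum of squares for a noisy autoregression -/

section Autoregression

variable {Ω : Type u} {mΩ : MeasurableSpace Ω} {P : Measure Ω}

lemma memLp_two_mul_of_integrable_pow_four {f g : Ω → ℝ} (hf : AEStronglyMeasurable f P)
    (hg : AEStronglyMeasurable g P) (hf4 : Integrable (fun ω => f ω ^ 4) P)
    (hg4 : Integrable (fun ω => g ω ^ 4) P) : MemLp (fun ω => f ω * g ω) 2 P := by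
  rw [memLp_two_iff_integrable_sq (hf.fun_mul hg)]
  refine (hf4.add hg4).mono' ((hf.mul hg).pow 2) (ae_of_all _ fun ω => ?_)
  rw [Real.norm_of_nonneg (sq_nonneg _)]
  simp only [Pi.add_apply]
  nlinarith [sq_nonneg (f ω ^ 2 - g ω ^ 2), sq_nonneg (f ω ^ 2), sq_nonneg (g ω ^ 2)]

lemma memLp_two_sq_of_integrable_pow_four {f : Ω → ℝ} (hf : AEStronglyMeasurable f P)
    (hf4 : Integrable (fun ω => f ω ^ 4) P) : MemLp (fun ω => f ω ^ 2) 2 P := by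
  simpa only [sq] using memLp_two_mul_of_integrable_pow_four hf hf hf4 hf4

/-- A stationary sequence of pairs of innovations `(η_n, ε_n)`, independent of the past `ℱ n`,
drives the autoregression `Y_{n+1} = ρ Y_n + η_n`; the fourth moments are controlled by `B`. -/
structure IsAutoregression (P : Measure Ω) (ℱ : ℕ → MeasurableSpace Ω) (Y η ε : ℕ → Ω → ℝ)
    (ρ q r B : ℝ) : Prop where
  mono : Monotone ℱ
  le : ∀ n, ℱ n ≤ mΩ
  measurable_init : Measurable[ℱ 0] (Y 0)
  measurable_eta : ∀ n, Measurable[ℱ (n + 1)] (η n)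
  measurable_eps : ∀ n, Measurable[ℱ (n + 1)] (ε n)
  indep : ∀ n, Indep (ℱ n) (MeasurableSpace.comap (fun ω => (η n ω, ε n ω)) inferInstance) P
  rec_eq : ∀ n ω, Y (n + 1) ω = ρ * Y n ω + η n ω
  rho_nonneg : 0 ≤ ρ
  rho_lt_one : ρ < 1
  integral_eta : ∀ n, ∫ ω, η n ω ∂P = 0
  integral_eps : ∀ n, ∫ ω, ε n ω ∂P = 0
  integral_eta_sq : ∀ n, ∫ ω, η n ω ^ 2 ∂P = q
  integral_eps_sq : ∀ n, ∫ ω, ε n ω ^ 2 ∂P = r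
  integrable_init : Integrable (fun ω => Y 0 ω ^ 4) P
  integrable_eta : ∀ n, Integrable (fun ω => η n ω ^ 4) P
  integrable_eps : ∀ n, Integrable (fun ω => ε n ω ^ 4) P
  integral_init_le : ∫ ω, Y 0 ω ^ 4 ∂P ≤ B
  integral_eta_le : ∀ n, ∫ ω, η n ω ^ 4 ∂P ≤ (1 - ρ) ^ 4 * B
  integral_eps_le : ∀ n, ∫ ω, ε n ω ^ 4 ∂P ≤ B

namespace IsAutoregression

variable {ℱ : ℕ → MeasurableSpace Ω} {Y η ε : ℕ → Ω → ℝ} {ρ q r B : ℝ}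

lemma measurable_Y (h : IsAutoregression P ℱ Y η ε ρ q r B) (n : ℕ) : Measurable[ℱ n] (Y n) := by
  induction n with
  | zero => exact h.measurable_init
  | succ n ih =>
    have : Y (n + 1) = fun ω => ρ * Y n ω + η n ω := funext (h.rec_eq n)
    rw [this]
    have ih' := ih.mono (h.mono n.le_succ) le_rfl
    exact (ih'.const_mul ρ).add (h.measurable_eta n)

lemma measurable_Y' (h : IsAutoregression P ℱ Y η ε ρ q r B) (n : ℕ) : Measurable (Y n) :=
  (h.measurable_Y n).mono (h.le n) le_rfl

lemma measurable_eta' (h : IsAutoregression P ℱ Y η ε ρ q r B) (n : ℕ) : Measurable (η n) :=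
  (h.measurable_eta n).mono (h.le _) le_rfl

lemma measurable_eps' (h : IsAutoregression P ℱ Y η ε ρ q r B) (n : ℕ) : Measurable (ε n) :=
  (h.measurable_eps n).mono (h.le _) le_rfl

lemma indepFun (h : IsAutoregression P ℱ Y η ε ρ q r B) {n : ℕ} {Z : Ω → ℝ}
    (hZ : Measurable[ℱ n] Z) {φ : ℝ × ℝ → ℝ} (hφ : Measurable φ) :
    IndepFun Z (fun ω => φ (η n ω, ε n ω)) P := by
  have h1 : IndepFun Z (fun ω => (η n ω, ε n ω)) P := by
    rw [IndepFun_iff_Indep]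
    exact indep_of_indep_of_le_left (h.indep n) hZ.comap_le
  exact h1.comp measurable_id hφ

lemma integral_mul_eq_zero (h : IsAutoregression P ℱ Y η ε ρ q r B) {n : ℕ} {Z : Ω → ℝ}
    (hZ : Measurable[ℱ n] Z) {φ : ℝ × ℝ → ℝ} (hφ : Measurable φ)
    (h0 : ∫ ω, φ (η n ω, ε n ω) ∂P = 0) : ∫ ω, Z ω * φ (η n ω, ε n ω) ∂P = 0 := by
  rw [(h.indepFun hZ hφ).integral_fun_mul_eq_mul_integral
    (hZ.mono (h.le n) le_rfl).aestronglyMeasurable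
    (hφ.comp ((h.measurable_eta' n).prodMk (h.measurable_eps' n))).aestronglyMeasurable, h0,
    mul_zero]

/-- Convexity of `x⁴` at `ρ Y + (1 - ρ) (η / (1 - ρ))`. With the factor `(1 - ρ)⁴` in the bound on
`E η⁴`, the same `B` then bounds every `E Y_n⁴`. -/
lemma pow_four_rec_le (h : IsAutoregression P ℱ Y η ε ρ q r B) (n : ℕ) (ω : Ω) :
    Y (n + 1) ω ^ 4 ≤ ρ * Y n ω ^ 4 + (1 - ρ) * (η n ω ^ 4 / (1 - ρ) ^ 4) := by
  have h1 : 0 < 1 - ρ := sub_pos.2 h.rho_lt_one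
  have hc := (even_two_mul 2).convexOn_pow (𝕜 := ℝ) |>.2 (Set.mem_univ (Y n ω))
    (Set.mem_univ (η n ω / (1 - ρ))) h.rho_nonneg h1.le (by ring)
  simp only [smul_eq_mul] at hc
  rw [mul_div_cancel₀ _ h1.ne', div_pow] at hc
  rw [h.rec_eq]
  exact hc

lemma integrable_Y (h : IsAutoregression P ℱ Y η ε ρ q r B) (n : ℕ) :
    Integrable (fun ω => Y n ω ^ 4) P := by
  induction n with
  | zero => exact h.integrable_init
  | succ n ih =>
    refine ((ih.const_mul ρ).add (((h.integrable_eta n).div_const ((1 - ρ) ^ 4)).const_mul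
      (1 - ρ))).mono' ((h.measurable_Y' (n + 1)).pow_const 4).aestronglyMeasurable
      (ae_of_all _ fun ω => ?_)
    rw [Real.norm_of_nonneg (by positivity)]
    exact h.pow_four_rec_le n ω

lemma integral_Y_le (h : IsAutoregression P ℱ Y η ε ρ q r B) (n : ℕ) :
    ∫ ω, Y n ω ^ 4 ∂P ≤ B := by
  have h1 : 0 < 1 - ρ := sub_pos.2 h.rho_lt_one
  induction n with
  | zero => exact h.integral_init_le
  | succ n ih =>
    have hη := ((h.integrable_eta n).div_const ((1 - ρ) ^ 4)).const_mul (1 - ρ)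
    calc ∫ ω, Y (n + 1) ω ^ 4 ∂P
        ≤ ∫ ω, (ρ * Y n ω ^ 4 + (1 - ρ) * (η n ω ^ 4 / (1 - ρ) ^ 4)) ∂P :=
          integral_mono (h.integrable_Y _) (((h.integrable_Y n).const_mul ρ).add hη)
            (h.pow_four_rec_le n)
      _ = ρ * ∫ ω, Y n ω ^ 4 ∂P + (1 - ρ) * ((∫ ω, η n ω ^ 4 ∂P) / (1 - ρ) ^ 4) := by
          rw [integral_add ((h.integrable_Y n).const_mul ρ) hη, integral_const_mul,
            integral_const_mul, integral_div]
      _ ≤ ρ * B + (1 - ρ) * B := by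
          have h2 : (∫ ω, η n ω ^ 4 ∂P) / (1 - ρ) ^ 4 ≤ B := by
            rw [div_le_iff₀' (by positivity)]; exact h.integral_eta_le n
          have := h.rho_nonneg
          gcongr
      _ = B := by ring

lemma bound_nonneg (h : IsAutoregression P ℱ Y η ε ρ q r B) : 0 ≤ B :=
  (integral_nonneg fun ω => by positivity).trans h.integral_init_le

lemma integral_eta_le' (h : IsAutoregression P ℱ Y η ε ρ q r B) (n : ℕ) :
    ∫ ω, η n ω ^ 4 ∂P ≤ B := by
  refine (h.integral_eta_le n).trans (mul_le_of_le_one_left h.bound_nonneg ?_)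
  exact pow_le_one₀ (sub_pos.2 h.rho_lt_one).le (by linarith [h.rho_nonneg])

/-- The martingale part of the centred sum `∑_{k<n} (κ Y_k + ε_k)²`. -/
def mart (Y ε : ℕ → Ω → ℝ) (κ l Φ : ℝ) (n : ℕ) (ω : Ω) : ℝ :=
  ∑ k ∈ Finset.range n, ((κ * Y k ω + ε k ω) ^ 2 - Φ) - l * (Y 0 ω ^ 2 - Y n ω ^ 2)

/-- The increments of `mart`. -/
def martDiff (Y η ε : ℕ → Ω → ℝ) (ρ q r κ l : ℝ) (n : ℕ) (ω : Ω) : ℝ :=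
  2 * l * ρ * (Y n ω * η n ω) + 2 * κ * (Y n ω * ε n ω) + l * (η n ω ^ 2 - q) +
    (ε n ω ^ 2 - r)

variable {κ l : ℝ}

/-- The relation `hl` is the Poisson equation for `κ² y²`: adding `l Y_n²` cancels the coefficient
`κ² + l ρ² - l` of `Y_n²`. What remains is centred given the past. -/
lemma mart_succ (h : IsAutoregression P ℱ Y η ε ρ q r B) (hl : l * (1 - ρ ^ 2) = κ ^ 2)
    (n : ℕ) (ω : Ω) :
    mart Y ε κ l (l * q + r) (n + 1) ω =
      mart Y ε κ l (l * q + r) n ω + martDiff Y η ε ρ q r κ l n ω := by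
  unfold mart martDiff
  rw [Finset.sum_range_succ, h.rec_eq]
  linear_combination -(Y n ω) ^ 2 * hl

lemma measurable_mart (h : IsAutoregression P ℱ Y η ε ρ q r B) (Φ : ℝ) (n : ℕ) :
    Measurable[ℱ n] (mart Y ε κ l Φ n) := by
  have h0 := (h.measurable_Y 0).mono (h.mono n.zero_le) le_rfl
  have hn := h.measurable_Y n
  refine Measurable.sub ?_ (((h0.pow_const 2).sub (hn.pow_const 2)).const_mul l)
  refine Finset.measurable_fun_sum _ fun k hk => ?_
  have hk' : k + 1 ≤ n := Finset.mem_range.1 hk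
  have h1 := (h.measurable_Y k).mono (h.mono (k.le_succ.trans hk')) le_rfl
  have h2 := (h.measurable_eps k).mono (h.mono hk') le_rfl
  exact (((h1.const_mul κ).add h2).pow_const 2).sub_const Φ

variable [IsProbabilityMeasure P]

lemma memLp_martDiff (h : IsAutoregression P ℱ Y η ε ρ q r B) (n : ℕ) :
    MemLp (martDiff Y η ε ρ q r κ l n) 2 P := by
  have hY := (h.measurable_Y' n).aestronglyMeasurable (μ := P)
  have hη := (h.measurable_eta' n).aestronglyMeasurable (μ := P)
  have hε := (h.measurable_eps' n).aestronglyMeasurable (μ := P)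
  exact ((((memLp_two_mul_of_integrable_pow_four hY hη (h.integrable_Y n)
    (h.integrable_eta n)).const_mul _).add ((memLp_two_mul_of_integrable_pow_four hY hε
    (h.integrable_Y n) (h.integrable_eps n)).const_mul _)).add
    (((memLp_two_sq_of_integrable_pow_four hη (h.integrable_eta n)).sub
    (memLp_const q)).const_mul l)).add
    ((memLp_two_sq_of_integrable_pow_four hε (h.integrable_eps n)).sub (memLp_const r))

lemma memLp_mart (h : IsAutoregression P ℱ Y η ε ρ q r B) (hl : l * (1 - ρ ^ 2) = κ ^ 2)
    (n : ℕ) : MemLp (mart Y ε κ l (l * q + r) n) 2 P := by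
  induction n with
  | zero =>
    have : mart Y ε κ l (l * q + r) 0 = fun _ => 0 := by
      funext ω; simp [mart]
    rw [this]
    exact memLp_const 0
  | succ n ih =>
    have : mart Y ε κ l (l * q + r) (n + 1) =
        mart Y ε κ l (l * q + r) n + martDiff Y η ε ρ q r κ l n :=
      funext (h.mart_succ hl n)
    rw [this]
    exact ih.add (h.memLp_martDiff n)

lemma sq_integral_sq_le {f : Ω → ℝ} (hf : MemLp (fun ω => f ω ^ 2) 2 P) :
    (∫ ω, f ω ^ 2 ∂P) ^ 2 ≤ ∫ ω, f ω ^ 4 ∂P := by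
  have h1 := variance_eq_sub hf
  have h2 := variance_nonneg (fun ω => f ω ^ 2) P
  have h3 : ∫ ω, ((fun ω => f ω ^ 2) ^ 2) ω ∂P = ∫ ω, f ω ^ 4 ∂P := by
    congr 1; funext ω; simp only [Pi.pow_apply]; ring
  rw [h3] at h1
  linarith

/-- Each term is a variable known at time `n` times a centred function of `(η_n, ε_n)`. No product
`η_n ε_n` occurs, so the correlation of the two innovations is harmless. -/
lemma integral_mart_mul_martDiff (h : IsAutoregression P ℱ Y η ε ρ q r B)
    (hl : l * (1 - ρ ^ 2) = κ ^ 2) (n : ℕ) :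
    ∫ ω, mart Y ε κ l (l * q + r) n ω * martDiff Y η ε ρ q r κ l n ω ∂P = 0 := by
  have hY := (h.measurable_Y' n).aestronglyMeasurable (μ := P)
  have hη := (h.measurable_eta' n).aestronglyMeasurable (μ := P)
  have hε := (h.measurable_eps' n).aestronglyMeasurable (μ := P)
  have hη2 := memLp_two_sq_of_integrable_pow_four hη (h.integrable_eta n)
  have hε2 := memLp_two_sq_of_integrable_pow_four hε (h.integrable_eps n)
  have hM := h.measurable_mart (κ := κ) (l := l) (l * q + r) n
  have hM2 := h.memLp_mart hl n
  set M := mart Y ε κ l (l * q + r) n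
  have i1 : Integrable (fun ω => M ω * (Y n ω * η n ω)) P :=
    hM2.integrable_mul (memLp_two_mul_of_integrable_pow_four hY hη (h.integrable_Y n)
      (h.integrable_eta n))
  have i2 : Integrable (fun ω => M ω * (Y n ω * ε n ω)) P :=
    hM2.integrable_mul (memLp_two_mul_of_integrable_pow_four hY hε (h.integrable_Y n)
      (h.integrable_eps n))
  have i3 : Integrable (fun ω => M ω * (η n ω ^ 2 - q)) P :=
    hM2.integrable_mul (hη2.sub (memLp_const q))
  have i4 : Integrable (fun ω => M ω * (ε n ω ^ 2 - r)) P :=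
    hM2.integrable_mul (hε2.sub (memLp_const r))
  have e1 : ∫ ω, M ω * (Y n ω * η n ω) ∂P = 0 := by
    simp_rw [← mul_assoc]
    exact h.integral_mul_eq_zero (Z := fun ω => M ω * Y n ω) (hM.mul (h.measurable_Y n))
      measurable_fst (h.integral_eta n)
  have e2 : ∫ ω, M ω * (Y n ω * ε n ω) ∂P = 0 := by
    simp_rw [← mul_assoc]
    exact h.integral_mul_eq_zero (Z := fun ω => M ω * Y n ω) (hM.mul (h.measurable_Y n))
      measurable_snd (h.integral_eps n)
  have e3 : ∫ ω, M ω * (η n ω ^ 2 - q) ∂P = 0 := by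
    refine h.integral_mul_eq_zero hM (φ := fun x => x.1 ^ 2 - q) (by fun_prop) ?_
    rw [integral_sub (hη2.integrable (by norm_num)) (integrable_const q), h.integral_eta_sq]
    simp
  have e4 : ∫ ω, M ω * (ε n ω ^ 2 - r) ∂P = 0 := by
    refine h.integral_mul_eq_zero hM (φ := fun x => x.2 ^ 2 - r) (by fun_prop) ?_
    rw [integral_sub (hε2.integrable (by norm_num)) (integrable_const r), h.integral_eps_sq]
    simp
  have : ∀ ω, M ω * martDiff Y η ε ρ q r κ l n ω =
      2 * l * ρ * (M ω * (Y n ω * η n ω)) + 2 * κ * (M ω * (Y n ω * ε n ω)) +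
        l * (M ω * (η n ω ^ 2 - q)) + M ω * (ε n ω ^ 2 - r) := fun ω => by
    unfold martDiff; ring
  simp_rw [this]
  rw [integral_add (((i1.const_mul _).fun_add (i2.const_mul _)).fun_add (i3.const_mul _)) i4,
    integral_add ((i1.const_mul _).fun_add (i2.const_mul _)) (i3.const_mul _),
    integral_add (i1.const_mul _) (i2.const_mul _), integral_const_mul, integral_const_mul,
    integral_const_mul, e1, e2, e3, e4]
  ring

lemma martDiff_sq_le (hρ : 0 ≤ ρ) (hρ1 : ρ < 1) (y e f : ℝ) (hq : 0 ≤ q) (hr : 0 ≤ r) :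
    (2 * l * ρ * (y * e) + 2 * κ * (y * f) + l * (e ^ 2 - q) + (f ^ 2 - r)) ^ 2 ≤
      (8 * l ^ 2 + 8 * κ ^ 2) * y ^ 4 + 12 * l ^ 2 * e ^ 4 + (8 * κ ^ 2 + 4) * f ^ 4 +
        (4 * l ^ 2 * q ^ 2 + 4 * r ^ 2) := by
  have h4 : ∀ a b c d : ℝ, (a + b + c + d) ^ 2 ≤ 4 * (a ^ 2 + b ^ 2 + c ^ 2 + d ^ 2) := by
    intro a b c d
    nlinarith [sq_nonneg (a - b), sq_nonneg (a - c), sq_nonneg (a - d), sq_nonneg (b - c),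
      sq_nonneg (b - d), sq_nonneg (c - d)]
  refine (h4 _ _ _ _).trans ?_
  have hye : ∀ u v : ℝ, (u * v) ^ 2 ≤ (u ^ 4 + v ^ 4) / 2 := fun u v => by
    nlinarith [sq_nonneg (u ^ 2 - v ^ 2)]
  have hsub : ∀ u p : ℝ, 0 ≤ p → (u ^ 2 - p) ^ 2 ≤ u ^ 4 + p ^ 2 := fun u p hp => by
    nlinarith [mul_nonneg (sq_nonneg u) hp]
  have hρ2 : ρ ^ 2 ≤ 1 := pow_le_one₀ hρ hρ1.le
  have a1 : (2 * l * ρ * (y * e)) ^ 2 ≤ 2 * l ^ 2 * (y ^ 4 + e ^ 4) := by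
    calc (2 * l * ρ * (y * e)) ^ 2 = ρ ^ 2 * (4 * l ^ 2 * (y * e) ^ 2) := by ring
      _ ≤ 1 * (4 * l ^ 2 * ((y ^ 4 + e ^ 4) / 2)) := by gcongr; exact hye y e
      _ = _ := by ring
  have a2 : (2 * κ * (y * f)) ^ 2 ≤ 2 * κ ^ 2 * (y ^ 4 + f ^ 4) := by
    calc (2 * κ * (y * f)) ^ 2 = 4 * κ ^ 2 * (y * f) ^ 2 := by ring
      _ ≤ 4 * κ ^ 2 * ((y ^ 4 + f ^ 4) / 2) := by gcongr; exact hye y f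
      _ = _ := by ring
  have a3 : (l * (e ^ 2 - q)) ^ 2 ≤ l ^ 2 * (e ^ 4 + q ^ 2) := by
    rw [mul_pow]; gcongr; exact hsub e q hq
  have a4 := hsub f r hr
  linarith

lemma integral_martDiff_sq_le (h : IsAutoregression P ℱ Y η ε ρ q r B) (n : ℕ) :
    ∫ ω, martDiff Y η ε ρ q r κ l n ω ^ 2 ∂P ≤ (24 * l ^ 2 + 16 * κ ^ 2 + 8) * B := by
  have hη := (h.measurable_eta' n).aestronglyMeasurable (μ := P)
  have hε := (h.measurable_eps' n).aestronglyMeasurable (μ := P)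
  have hη2 := memLp_two_sq_of_integrable_pow_four hη (h.integrable_eta n)
  have hε2 := memLp_two_sq_of_integrable_pow_four hε (h.integrable_eps n)
  have hq : 0 ≤ q := by rw [← h.integral_eta_sq n]; exact integral_nonneg fun ω => sq_nonneg _
  have hr : 0 ≤ r := by rw [← h.integral_eps_sq n]; exact integral_nonneg fun ω => sq_nonneg _
  have hqB : q ^ 2 ≤ B := by
    rw [← h.integral_eta_sq n]; exact (sq_integral_sq_le hη2).trans (h.integral_eta_le' n)
  have hrB : r ^ 2 ≤ B := by
    rw [← h.integral_eps_sq n]; exact (sq_integral_sq_le hε2).trans (h.integral_eps_le n)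
  have j1 := (h.integrable_Y n).const_mul (8 * l ^ 2 + 8 * κ ^ 2)
  have j2 := (h.integrable_eta n).const_mul (12 * l ^ 2)
  have j3 := (h.integrable_eps n).const_mul (8 * κ ^ 2 + 4)
  calc ∫ ω, martDiff Y η ε ρ q r κ l n ω ^ 2 ∂P
      ≤ ∫ ω, ((8 * l ^ 2 + 8 * κ ^ 2) * Y n ω ^ 4 + 12 * l ^ 2 * η n ω ^ 4 +
          (8 * κ ^ 2 + 4) * ε n ω ^ 4 + (4 * l ^ 2 * q ^ 2 + 4 * r ^ 2)) ∂P :=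
        integral_mono (h.memLp_martDiff n).integrable_sq
          (((j1.fun_add j2).fun_add j3).add (integrable_const _))
          fun ω => martDiff_sq_le h.rho_nonneg h.rho_lt_one _ _ _ hq hr
    _ = (8 * l ^ 2 + 8 * κ ^ 2) * ∫ ω, Y n ω ^ 4 ∂P + 12 * l ^ 2 * ∫ ω, η n ω ^ 4 ∂P +
          (8 * κ ^ 2 + 4) * ∫ ω, ε n ω ^ 4 ∂P + (4 * l ^ 2 * q ^ 2 + 4 * r ^ 2) := by
        rw [integral_add ((j1.fun_add j2).fun_add j3) (integrable_const _), integral_add (j1.fun_add j2) j3,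
          integral_add j1 j2, integral_const_mul, integral_const_mul, integral_const_mul]
        simp
    _ ≤ (8 * l ^ 2 + 8 * κ ^ 2) * B + 12 * l ^ 2 * B +
          (8 * κ ^ 2 + 4) * B + (4 * l ^ 2 * B + 4 * B) := by
        have := h.integral_Y_le n
        have := h.integral_eta_le' n
        have := h.integral_eps_le n
        gcongr
    _ = _ := by ring

lemma integral_mart_sq_le (h : IsAutoregression P ℱ Y η ε ρ q r B)
    (hl : l * (1 - ρ ^ 2) = κ ^ 2) (n : ℕ) :
    ∫ ω, mart Y ε κ l (l * q + r) n ω ^ 2 ∂P ≤ n * ((24 * l ^ 2 + 16 * κ ^ 2 + 8) * B) := by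
  induction n with
  | zero => simp [mart]
  | succ n ih =>
    have i1 := (h.memLp_mart hl n).integrable_sq
    have i2 : Integrable (fun ω => mart Y ε κ l (l * q + r) n ω * martDiff Y η ε ρ q r κ l n ω) P :=
      (h.memLp_mart hl n).integrable_mul (h.memLp_martDiff n)
    have i3 := (h.memLp_martDiff (κ := κ) (l := l) n).integrable_sq
    have : ∀ ω, mart Y ε κ l (l * q + r) (n + 1) ω ^ 2 =
        mart Y ε κ l (l * q + r) n ω ^ 2 +
        2 * (mart Y ε κ l (l * q + r) n ω * martDiff Y η ε ρ q r κ l n ω) +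
        martDiff Y η ε ρ q r κ l n ω ^ 2 := fun ω => by
      rw [h.mart_succ hl]; ring
    simp_rw [this]
    rw [integral_add (i1.fun_add (i2.const_mul 2)) i3, integral_add i1 (i2.const_mul 2),
      integral_const_mul, h.integral_mart_mul_martDiff hl]
    have := h.integral_martDiff_sq_le (κ := κ) (l := l) n
    push_cast
    linarith

/-- The mean square of the centred sum of squares grows at most linearly. -/
theorem integral_sum_sq_sub_sq_le (h : IsAutoregression P ℱ Y η ε ρ q r B)
    (hl : l * (1 - ρ ^ 2) = κ ^ 2) {n : ℕ} (hn : 1 ≤ n) :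
    MemLp (fun ω => ∑ k ∈ Finset.range n, ((κ * Y k ω + ε k ω) ^ 2 - (l * q + r))) 2 P ∧
    ∫ ω, (∑ k ∈ Finset.range n, ((κ * Y k ω + ε k ω) ^ 2 - (l * q + r))) ^ 2 ∂P ≤
      n * ((52 * l ^ 2 + 32 * κ ^ 2 + 16) * B) := by
  have hY2 := fun k => memLp_two_sq_of_integrable_pow_four
    (h.measurable_Y' k).aestronglyMeasurable (h.integrable_Y k)
  have hM := h.memLp_mart hl n
  have hQ : MemLp (fun ω => ∑ k ∈ Finset.range n,
      ((κ * Y k ω + ε k ω) ^ 2 - (l * q + r))) 2 P := by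
    convert hM.add (((hY2 0).sub (hY2 n)).const_mul l) using 1
    funext ω
    simp [mart]
  refine ⟨hQ, ?_⟩
  have i0 := (h.integrable_Y 0).const_mul (2 * l ^ 2)
  have i1 := (h.integrable_Y n).const_mul (2 * l ^ 2)
  have i2 := hM.integrable_sq.const_mul 2
  have hB := h.bound_nonneg
  have hn' : (1 : ℝ) ≤ n := by exact_mod_cast hn
  calc ∫ ω, (∑ k ∈ Finset.range n, ((κ * Y k ω + ε k ω) ^ 2 - (l * q + r))) ^ 2 ∂P
      ≤ ∫ ω, (2 * mart Y ε κ l (l * q + r) n ω ^ 2 + 2 * l ^ 2 * Y 0 ω ^ 4 +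
          2 * l ^ 2 * Y n ω ^ 4) ∂P := by
        refine integral_mono hQ.integrable_sq ((i2.fun_add i0).add i1) fun ω => ?_
        have e : ∑ k ∈ Finset.range n, ((κ * Y k ω + ε k ω) ^ 2 - (l * q + r)) =
            mart Y ε κ l (l * q + r) n ω + l * (Y 0 ω ^ 2 - Y n ω ^ 2) := by simp [mart]
        simp only [e]
        set m := mart Y ε κ l (l * q + r) n ω
        have h1 : (Y 0 ω ^ 2 - Y n ω ^ 2) ^ 2 ≤ Y 0 ω ^ 4 + Y n ω ^ 4 := by
          nlinarith [mul_nonneg (sq_nonneg (Y 0 ω)) (sq_nonneg (Y n ω))]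
        have h2 : l ^ 2 * (Y 0 ω ^ 2 - Y n ω ^ 2) ^ 2 ≤ l ^ 2 * (Y 0 ω ^ 4 + Y n ω ^ 4) := by
          gcongr
        nlinarith [sq_nonneg (m - l * (Y 0 ω ^ 2 - Y n ω ^ 2))]
    _ = 2 * ∫ ω, mart Y ε κ l (l * q + r) n ω ^ 2 ∂P + 2 * l ^ 2 * ∫ ω, Y 0 ω ^ 4 ∂P +
          2 * l ^ 2 * ∫ ω, Y n ω ^ 4 ∂P := by
        rw [integral_add (i2.fun_add i0) i1, integral_add i2 i0, integral_const_mul,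
          integral_const_mul, integral_const_mul]
    _ ≤ 2 * (n * ((24 * l ^ 2 + 16 * κ ^ 2 + 8) * B)) + 2 * l ^ 2 * B + 2 * l ^ 2 * B := by
        have := h.integral_mart_sq_le hl n
        have := h.integral_Y_le n
        have := h.integral_Y_le 0
        gcongr
    -- The boundary terms do not grow; `1 ≤ n` absorbs them into the linear bound.
    _ ≤ 2 * (n * ((24 * l ^ 2 + 16 * κ ^ 2 + 8) * B)) + n * (4 * l ^ 2 * B) := by
        nlinarith [mul_nonneg (sub_nonneg.2 hn') (mul_nonneg (sq_nonneg l) hB)]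
    _ = _ := by ring

end IsAutoregression

end Autoregression


/-- The weighted integral `∫₀¹ e^{-θ(1-s)} u_s ds` of a path. -/
noncomputable def expInt (θ : ℝ) (u : ℝ≥0 → ℝ) : ℝ :=
  ∫ s in (0 : ℝ)..1, Real.exp (-θ * (1 - s)) * u s.toNNReal

/-! ### The linear equation over a unit interval, path by path -/

section Path

lemma hasDerivAt_expWeight (θ t : ℝ) :
    HasDerivAt (fun s : ℝ => Real.exp (-θ * (1 - s))) (θ * Real.exp (-θ * (1 - t))) t := by
  have h : HasDerivAt (fun s : ℝ => -θ * (1 - s)) θ t := by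
    simpa using ((hasDerivAt_id t).const_sub 1).const_mul (-θ)
  simpa [mul_comm] using h.exp

lemma integral_expWeight {θ : ℝ} (hθ : θ ≠ 0) :
    ∫ s in (0 : ℝ)..1, Real.exp (-θ * (1 - s)) = (1 - Real.exp (-θ)) / θ := by
  rw [intervalIntegral.integral_eq_sub_of_hasDerivAt
    (f := fun s => Real.exp (-θ * (1 - s)) / θ)]
  · simp; ring
  · intro t _
    simpa [hθ] using (hasDerivAt_expWeight θ t).div_const θ
  · exact Continuous.intervalIntegrable (by fun_prop) _ _

/-- Variation of constants over a time interval of length one. -/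
lemma linear_equation_step {y v : ℝ≥0 → ℝ} (hy : Continuous y) (hv : Continuous v)
    {x θ b : ℝ} (hθ : θ ≠ 0)
    (h : ∀ t : ℝ≥0, y t = x - θ * (∫ s in (0 : ℝ)..t, y s.toNNReal) + b * v t) (c : ℝ≥0) :
    (∫ s in (0 : ℝ)..(c + 1 : ℝ≥0), y s.toNNReal) - (∫ s in (0 : ℝ)..c, y s.toNNReal) =
        (1 - Real.exp (-θ)) / θ * y c + b * expInt θ (fun s => v (c + s) - v c) ∧
    y (c + 1) = Real.exp (-θ) * y c +
      b * (v (c + 1) - v c - θ * expInt θ (fun s => v (c + s) - v c)) := by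
  have hyc : Continuous fun s : ℝ => y s.toNNReal := hy.comp continuous_real_toNNReal
  have hint : ∀ p q : ℝ, IntervalIntegrable (fun s : ℝ => y s.toNNReal) volume p q :=
    fun p q => hyc.intervalIntegrable _ _
  -- The path `v` need not be differentiable, but the integral `F` of `y` is, and it satisfies `F' =
  -- y c - θ F + b (v (c + ·) - v c)`.
  set F : ℝ → ℝ := fun t => ∫ s in (c : ℝ)..(c + t), y s.toNNReal with hF
  have hFderiv : ∀ t, HasDerivAt F (y ((c : ℝ) + t).toNNReal) t := fun t => by
    have h1 : HasDerivAt (fun r => ∫ s in (c : ℝ)..r, y s.toNNReal)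
        (y ((c : ℝ) + t).toNNReal) (c + t) :=
      intervalIntegral.integral_hasDerivAt_right (hint _ _)
        (hyc.stronglyMeasurableAtFilter _ _) hyc.continuousAt
    have h2 := HasDerivAt.comp_const_add (c : ℝ) t h1
    exact h2
  have hsub : ∀ t : ℝ≥0, F t = (∫ s in (0 : ℝ)..(c + t : ℝ≥0), y s.toNNReal) -
      (∫ s in (0 : ℝ)..c, y s.toNNReal) := fun t => by
    rw [intervalIntegral.integral_interval_sub_left (hint _ _) (hint _ _)]
    simp [hF]
  have hstep : ∀ t : ℝ≥0, y (c + t) = y c - θ * F t + b * (v (c + t) - v c) := fun t => by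
    rw [hsub, h (c + t), h c]; ring
  have hF1 : F 1 = (1 - Real.exp (-θ)) / θ * y c + b * expInt θ (fun s => v (c + s) - v c) := by
    have hcont : Continuous fun s : ℝ => Real.exp (-θ * (1 - s)) *
        (v (c + s.toNNReal) - v c) := by
      have := continuous_real_toNNReal
      fun_prop
    -- The integrating factor `e^{-θ(1-t)}` removes `θ F` from the equation.
    have hftc : ∫ t in (0 : ℝ)..1, (Real.exp (-θ * (1 - t)) * y c +
        b * (Real.exp (-θ * (1 - t)) * (v (c + t.toNNReal) - v c))) =
        Real.exp (-θ * (1 - 1)) * F 1 - Real.exp (-θ * (1 - 0)) * F 0 := by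
      apply intervalIntegral.integral_eq_sub_of_hasDerivAt
        (f := fun t => Real.exp (-θ * (1 - t)) * F t)
      · intro t ht
        rw [Set.uIcc_of_le zero_le_one] at ht
        refine ((hasDerivAt_expWeight θ t).mul (hFderiv t)).congr_deriv ?_
        have h1 := hstep t.toNNReal
        rw [Real.coe_toNNReal t ht.1] at h1
        have h2 : ((c : ℝ) + t).toNNReal = c + t.toNNReal := by
          rw [Real.toNNReal_add c.coe_nonneg ht.1]; simp
        rw [h2, h1]; ring
      · exact Continuous.intervalIntegrable
          (((by fun_prop : Continuous fun t : ℝ => Real.exp (-θ * (1 - t)) * y c)).add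
          (hcont.const_mul b)) _ _
    have hF0 : F 0 = 0 := by simp [hF]
    rw [intervalIntegral.integral_add
      (Continuous.intervalIntegrable (by fun_prop) _ _)
      ((hcont.const_mul b).intervalIntegrable _ _), intervalIntegral.integral_mul_const,
      intervalIntegral.integral_const_mul, integral_expWeight hθ, hF0] at hftc
    simp only [sub_self, mul_zero, Real.exp_zero, one_mul, sub_zero] at hftc
    rw [← hftc]; rfl
  have h1 := hsub 1
  rw [NNReal.coe_one] at h1
  refine ⟨by rw [← h1, hF1], ?_⟩
  have h2 := hstep 1
  rw [NNReal.coe_one, hF1] at h2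
  rw [h2]
  field_simp
  ring

end Path

/-! ### Moments of the weighted integral of Brownian motion -/

section Moments

variable {Ω : Type u} {mΩ : MeasurableSpace Ω} {P : Measure Ω}

/-- Cutting time at 1 shows that only `U t` with `t ≤ 1` matters. The σ-algebra is arbitrary, so
that the lemma serves both the past and the future increments. -/
lemma measurable_expInt {m : MeasurableSpace Ω} {U : ℝ≥0 → Ω → ℝ}
    (hc : ∀ ω, Continuous fun t => U t ω) (hm : ∀ t ≤ 1, Measurable[m] (U t)) (θ : ℝ) :
    Measurable[m] fun ω => expInt θ (fun t => U t ω) := by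
  have h1 : Measurable (Function.uncurry fun (s : ℝ) (ω : Ω) => U (min s.toNNReal 1) ω) := by
    apply measurable_uncurry_of_continuous_of_measurable
    · intro ω
      exact (hc ω).comp (by have := continuous_real_toNNReal; fun_prop)
    · intro s
      exact hm _ (min_le_right _ _)
  have h2 : Measurable (fun p : Ω × ℝ => Real.exp (-θ * (1 - p.2)) *
      U (min p.2.toNNReal 1) p.1) :=
    (by fun_prop : Measurable fun p : Ω × ℝ => Real.exp (-θ * (1 - p.2))).mul
      (h1.comp measurable_swap)
  have h3 : (fun ω => expInt θ (fun t => U t ω)) = fun ω => ∫ s in Set.Ioc (0 : ℝ) 1,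
      Real.exp (-θ * (1 - s)) * U (min s.toNNReal 1) ω := by
    funext ω
    rw [expInt, intervalIntegral.integral_of_le zero_le_one]
    refine setIntegral_congr_fun measurableSet_Ioc fun s hs => ?_
    have : s.toNNReal ≤ 1 := by simpa using hs.2
    simp only [min_eq_left this]
  rw [h3]
  exact (h2.stronglyMeasurable.integral_prod_right').measurable

/-- The fourth moment of the standard normal law. -/
noncomputable def normalFourthMoment : ℝ := ∫ x, x ^ 4 ∂(gaussianReal 0 1)

lemma normalFourthMoment_nonneg : 0 ≤ normalFourthMoment :=
  integral_nonneg fun x => by positivity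

lemma integrable_pow_four_gaussianReal (v : ℝ≥0) :
    Integrable (fun x : ℝ => x ^ 4) (gaussianReal 0 v) := by
  have h := (memLp_id_gaussianReal (μ := 0) (v := v) 4).integrable_norm_pow' 
  refine h.mono' (by fun_prop) (ae_of_all _ fun x => ?_)
  simp

lemma integral_pow_four_gaussianReal (v : ℝ≥0) :
    ∫ x, x ^ 4 ∂(gaussianReal 0 v) = (v : ℝ) ^ 2 * normalFourthMoment := by
  have h := gaussianReal_map_const_mul (μ := 0) (v := 1) (√(v : ℝ))
  have h1 : gaussianReal 0 v = (gaussianReal 0 1).map (fun x => √(v : ℝ) * x) := by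
    rw [h]; congr 1
    · simp
    · ext; simp
  rw [h1, integral_map (by fun_prop) (by fun_prop), normalFourthMoment, ← integral_const_mul]
  congr 1; funext x
  rw [mul_pow, show √(v : ℝ) ^ 4 = (√(v : ℝ) ^ 2) ^ 2 by ring, Real.sq_sqrt v.coe_nonneg]

lemma _root_.ProbabilityTheory.HasLaw.integrable_pow_four_of_gaussianReal {Z : Ω → ℝ} {v : ℝ≥0} (h : HasLaw Z (gaussianReal 0 v) P) :
    Integrable (fun ω => Z ω ^ 4) P := by
  have := integrable_pow_four_gaussianReal v
  rw [← h.map_eq] at this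
  exact this.comp_aemeasurable h.aemeasurable

lemma _root_.ProbabilityTheory.HasLaw.integral_pow_four_of_gaussianReal {Z : Ω → ℝ} {v : ℝ≥0} (h : HasLaw Z (gaussianReal 0 v) P) :
    ∫ ω, Z ω ^ 4 ∂P = (v : ℝ) ^ 2 * normalFourthMoment := by
  rw [← integral_pow_four_gaussianReal]
  exact h.integral_comp (f := fun x : ℝ => x ^ 4) (by fun_prop)

lemma _root_.ProbabilityTheory.HasLaw.integral_eq_zero_of_gaussianReal {Z : Ω → ℝ} {v : ℝ≥0} (h : HasLaw Z (gaussianReal 0 v) P) :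
    ∫ ω, Z ω ∂P = 0 := by
  rw [h.integral_eq, integral_id_gaussianReal]

lemma _root_.ProbabilityTheory.HasLaw.integral_sq_of_gaussianReal {Z : Ω → ℝ} {v : ℝ≥0} (h : HasLaw Z (gaussianReal 0 v) P) :
    ∫ ω, Z ω ^ 2 ∂P = v := by
  rw [← variance_of_integral_eq_zero h.aemeasurable h.integral_eq_zero_of_gaussianReal, h.variance_eq,
    variance_id_gaussianReal]

variable [IsProbabilityMeasure P]

instance isProbabilityMeasure_volume_Ioc :
    IsProbabilityMeasure ((volume : Measure ℝ).restrict (Set.Ioc 0 1)) := ⟨by simp⟩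

variable {U : ℝ≥0 → Ω → ℝ}

lemma measurable_uncurry_path (hc : ∀ ω, Continuous fun t => U t ω) (hm : ∀ t, Measurable (U t)) :
    Measurable fun p : Ω × ℝ => U p.2.toNNReal p.1 := by
  have := measurable_uncurry_of_continuous_of_measurable (u := U) hc hm
  exact this.comp (g := Function.uncurry U)
    (f := fun p : Ω × ℝ => (p.2.toNNReal, p.1)) (by fun_prop)

lemma integrable_prod_pow_four (hB : IsPreBrownianReal U P) (hc : ∀ ω, Continuous fun t => U t ω)
    (hm : ∀ t, Measurable (U t)) :
    Integrable (fun p : Ω × ℝ => U p.2.toNNReal p.1 ^ 4)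
      (P.prod (volume.restrict (Set.Ioc (0 : ℝ) 1))) := by
  have hmeas := (measurable_uncurry_path hc hm).pow_const 4
  rw [integrable_prod_iff' hmeas.aestronglyMeasurable]
  refine ⟨ae_of_all _ fun s => (hB.hasLaw_eval s.toNNReal).integrable_pow_four_of_gaussianReal, ?_⟩
  have : ∀ s : ℝ, ∫ ω, ‖U s.toNNReal ω ^ 4‖ ∂P =
      ((s.toNNReal : ℝ≥0) : ℝ) ^ 2 * normalFourthMoment := fun s => by
    rw [← (hB.hasLaw_eval s.toNNReal).integral_pow_four_of_gaussianReal]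
    congr 1; funext ω
    exact Real.norm_of_nonneg (by positivity)
  refine Integrable.congr ?_ (ae_of_all _ fun s => (this s).symm)
  have hcont : Continuous fun s : ℝ => ((s.toNNReal : ℝ≥0) : ℝ) ^ 2 * normalFourthMoment := by
    have := continuous_real_toNNReal
    fun_prop
  have hI := (hcont.integrableOn_Icc (μ := volume) (a := 0) (b := 1)).mono_set
    Set.Ioc_subset_Icc_self
  exact hI

lemma expWeight_le_one {θ s : ℝ} (hθ : 0 ≤ θ) (hs : s ≤ 1) : Real.exp (-θ * (1 - s)) ≤ 1 := by
  rw [Real.exp_le_one_iff]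
  nlinarith

lemma expInt_pow_four_le {θ : ℝ} (hθ : 0 ≤ θ) {u : ℝ≥0 → ℝ} (hu : Continuous u) :
    expInt θ u ^ 4 ≤ ∫ s in Set.Ioc (0 : ℝ) 1, u s.toNNReal ^ 4 := by
  have hcu : Continuous fun s : ℝ => u s.toNNReal := hu.comp continuous_real_toNNReal
  have hcg : Continuous fun s : ℝ => Real.exp (-θ * (1 - s)) * u s.toNNReal := by fun_prop
  have hi : ∀ {f : ℝ → ℝ}, Continuous f → IntegrableOn f (Set.Ioc 0 1) := fun hf =>
    (hf.integrableOn_Icc (a := 0) (b := 1)).mono_set Set.Ioc_subset_Icc_self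
  rw [expInt, intervalIntegral.integral_of_le zero_le_one]
  have hJ := ConvexOn.map_integral_le (μ := volume.restrict (Set.Ioc (0 : ℝ) 1))
    ((even_two_mul 2).convexOn_pow (𝕜 := ℝ)) (by fun_prop) isClosed_univ
    (ae_of_all _ fun _ => Set.mem_univ _) (hi hcg) (hi (hcg.pow (2 * 2)))
  refine hJ.trans (setIntegral_mono_on (hi (hcg.pow 4)) (hi (hcu.pow 4)) measurableSet_Ioc ?_)
  intro s hs
  change (Real.exp (-θ * (1 - s)) * u s.toNNReal) ^ 4 ≤ _
  rw [mul_pow]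
  exact mul_le_of_le_one_left (by positivity)
    (pow_le_one₀ (Real.exp_pos _).le (expWeight_le_one hθ hs.2))

lemma expInt_pow_four_moment (hB : IsPreBrownianReal U P) (hc : ∀ ω, Continuous fun t => U t ω)
    (hm : ∀ t, Measurable (U t)) {θ : ℝ} (hθ : 0 ≤ θ) :
    Integrable (fun ω => expInt θ (fun t => U t ω) ^ 4) P ∧
      ∫ ω, expInt θ (fun t => U t ω) ^ 4 ∂P ≤ normalFourthMoment := by
  have hint := integrable_prod_pow_four hB hc hm
  have hmeas := measurable_expInt hc (fun t _ => hm t) θ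
  have hJ : Integrable (fun ω => expInt θ (fun t => U t ω) ^ 4) P := by
    refine hint.integral_prod_left.mono' (hmeas.pow_const 4).aestronglyMeasurable
      (ae_of_all _ fun ω => ?_)
    rw [Real.norm_of_nonneg (by positivity)]
    exact expInt_pow_four_le hθ (hc ω)
  refine ⟨hJ, ?_⟩
  calc ∫ ω, expInt θ (fun t => U t ω) ^ 4 ∂P
      ≤ ∫ ω, (∫ s in Set.Ioc (0 : ℝ) 1, U s.toNNReal ω ^ 4) ∂P :=
        integral_mono hJ hint.integral_prod_left fun ω => expInt_pow_four_le hθ (hc ω)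
    _ = ∫ s in Set.Ioc (0 : ℝ) 1, ∫ ω, U s.toNNReal ω ^ 4 ∂P := integral_integral_swap hint
    _ ≤ ∫ s in Set.Ioc (0 : ℝ) 1, normalFourthMoment := by
        refine setIntegral_mono_on hint.integral_prod_right (integrable_const _)
          measurableSet_Ioc fun s hs => ?_
        rw [(hB.hasLaw_eval s.toNNReal).integral_pow_four_of_gaussianReal, Real.coe_toNNReal _ hs.1.le]
        exact mul_le_of_le_one_left normalFourthMoment_nonneg (pow_le_one₀ hs.1.le hs.2)
    _ = normalFourthMoment := by simp

/-- Fubini. Used with `H = 1` for the mean, `H = U t` for the covariance, and `H` the weighted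
integral itself for the second moment. -/
lemma integral_mul_expInt (hB : IsPreBrownianReal U P) (hc : ∀ ω, Continuous fun t => U t ω)
    (hm : ∀ t, Measurable (U t)) {θ : ℝ} (hθ : 0 ≤ θ) {H : Ω → ℝ} (hH : Measurable H)
    (hH2 : MemLp H 2 P) :
    ∫ ω, H ω * expInt θ (fun t => U t ω) ∂P =
      ∫ s in (0 : ℝ)..1, Real.exp (-θ * (1 - s)) * ∫ ω, H ω * U s.toNNReal ω ∂P := by
  have hmeas := measurable_uncurry_path hc hm
  have hint : Integrable (fun p : Ω × ℝ => Real.exp (-θ * (1 - p.2)) *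
      (H p.1 * U p.2.toNNReal p.1)) (P.prod (volume.restrict (Set.Ioc (0 : ℝ) 1))) := by
    have h1 : Integrable (fun p : Ω × ℝ => H p.1 ^ 2)
        (P.prod (volume.restrict (Set.Ioc (0 : ℝ) 1))) := hH2.integrable_sq.comp_fst _
    -- The dominating function is `H² + U⁴ + 1`, from `|H U| ≤ (H² + U²)/2` and `U² ≤ U⁴ + 1/4`.
    refine ((h1.fun_add (integrable_prod_pow_four hB hc hm)).fun_add (integrable_const 1)).mono'
      (((by fun_prop : Measurable fun p : Ω × ℝ => Real.exp (-θ * (1 - p.2))).mul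
        ((hH.comp measurable_fst).mul hmeas)).aestronglyMeasurable) ?_
    have hmem : ∀ᵐ p : Ω × ℝ ∂(P.prod (volume.restrict (Set.Ioc (0 : ℝ) 1))), p.2 ≤ 1 := by
      have h0 : ∀ᵐ s : ℝ ∂(volume.restrict (Set.Ioc (0 : ℝ) 1)), s ≤ 1 :=
        (ae_restrict_mem measurableSet_Ioc).mono fun s hs => hs.2
      exact Measure.quasiMeasurePreserving_snd.ae h0
    filter_upwards [hmem] with p hp
    rw [norm_mul, Real.norm_of_nonneg (Real.exp_pos _).le, norm_mul]
    simp only [Real.norm_eq_abs]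
    have h2 : Real.exp (-θ * (1 - p.2)) * (|H p.1| * |U p.2.toNNReal p.1|) ≤
        |H p.1| * |U p.2.toNNReal p.1| :=
      mul_le_of_le_one_left (by positivity) (expWeight_le_one hθ hp)
    refine h2.trans ?_
    have h3 := sq_abs (H p.1)
    have h4 : |U p.2.toNNReal p.1| ^ 4 = U p.2.toNNReal p.1 ^ 4 := by
      rw [← abs_pow, abs_of_nonneg (by positivity)]
    rw [← h3, ← h4]
    nlinarith [sq_nonneg (|H p.1| - |U p.2.toNNReal p.1|),
      sq_nonneg (|U p.2.toNNReal p.1| ^ 2 - 1 / 2)]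
  have hs := integral_integral_swap (f := fun ω s => Real.exp (-θ * (1 - s)) *
      (H ω * U s.toNNReal ω)) hint
  calc ∫ ω, H ω * expInt θ (fun t => U t ω) ∂P
      = ∫ ω, (∫ s in Set.Ioc (0 : ℝ) 1,
          Real.exp (-θ * (1 - s)) * (H ω * U s.toNNReal ω)) ∂P := by
        congr 1; funext ω
        rw [expInt, intervalIntegral.integral_of_le zero_le_one, ← integral_const_mul]
        congr 1; funext s; ring
    _ = ∫ s in Set.Ioc (0 : ℝ) 1, ∫ ω, Real.exp (-θ * (1 - s)) * (H ω * U s.toNNReal ω) ∂P := hs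
    _ = _ := by
        rw [intervalIntegral.integral_of_le zero_le_one]
        simp_rw [integral_const_mul]

lemma _root_.ProbabilityTheory.IsPreBrownianReal.integral_mul_eval (hB : IsPreBrownianReal U P) (s t : ℝ≥0) :
    ∫ ω, U s ω * U t ω ∂P = min s t := by
  have h := hB.covariance_eval s t
  rw [covariance_eq_sub (hB.isGaussianProcess.hasGaussianLaw_eval s).memLp_two
    (hB.isGaussianProcess.hasGaussianLaw_eval t).memLp_two, hB.integral_eval, hB.integral_eval]
    at h
  simpa using h

lemma integral_expInt (hB : IsPreBrownianReal U P) (hc : ∀ ω, Continuous fun t => U t ω)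
    (hm : ∀ t, Measurable (U t)) {θ : ℝ} (hθ : 0 ≤ θ) :
    ∫ ω, expInt θ (fun t => U t ω) ∂P = 0 := by
  have h := integral_mul_expInt hB hc hm hθ (H := fun _ => 1) measurable_const (memLp_const 1)
  simpa [hB.integral_eval] using h

lemma integral_eval_mul_expInt (hB : IsPreBrownianReal U P)
    (hc : ∀ ω, Continuous fun t => U t ω) (hm : ∀ t, Measurable (U t)) {θ : ℝ} (hθ : 0 < θ)
    {t : ℝ≥0} (ht : t ≤ 1) :
    ∫ ω, U t ω * expInt θ (fun t => U t ω) ∂P =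
      t / θ - (Real.exp (-θ * (1 - t)) - Real.exp (-θ)) / θ ^ 2 := by
  rw [integral_mul_expInt hB hc hm hθ.le (hm t)
    (hB.isGaussianProcess.hasGaussianLaw_eval t).memLp_two]
  simp_rw [hB.integral_mul_eval]
  have hcont : Continuous fun s : ℝ => Real.exp (-θ * (1 - s)) *
      ((min t s.toNNReal : ℝ≥0) : ℝ) := by
    have := continuous_real_toNNReal
    fun_prop
  -- The covariance `min t s` changes form at `s = t`.
  rw [← intervalIntegral.integral_add_adjacent_intervals
    (hcont.intervalIntegrable 0 (t : ℝ)) (hcont.intervalIntegrable (t : ℝ) 1)]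
  have ht1 : (t : ℝ) ≤ 1 := by exact_mod_cast ht
  have e1 : ∫ s in (0 : ℝ)..t, Real.exp (-θ * (1 - s)) * ((min t s.toNNReal : ℝ≥0) : ℝ) =
      ∫ s in (0 : ℝ)..t, Real.exp (-θ * (1 - s)) * s := by
    refine intervalIntegral.integral_congr fun s hs => ?_
    rw [Set.uIcc_of_le t.coe_nonneg] at hs
    have : s.toNNReal ≤ t := Real.toNNReal_le_iff_le_coe.2 hs.2
    simp only [min_eq_right this, Real.coe_toNNReal s hs.1]
  have e2 : ∫ s in (t : ℝ)..1, Real.exp (-θ * (1 - s)) * ((min t s.toNNReal : ℝ≥0) : ℝ) =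
      ∫ s in (t : ℝ)..1, Real.exp (-θ * (1 - s)) * t := by
    refine intervalIntegral.integral_congr fun s hs => ?_
    rw [Set.uIcc_of_le ht1] at hs
    have : t ≤ s.toNNReal := NNReal.le_toNNReal_of_coe_le hs.1
    simp only [min_eq_left this]
  rw [e1, e2, intervalIntegral.integral_eq_sub_of_hasDerivAt (f := fun s =>
      Real.exp (-θ * (1 - s)) * (s / θ - 1 / θ ^ 2)),
    intervalIntegral.integral_eq_sub_of_hasDerivAt (f := fun s =>
      Real.exp (-θ * (1 - s)) * (t / θ))]
  · simp
    field_simp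
    ring
  · intro s _
    refine ((hasDerivAt_expWeight θ s).mul_const ((t : ℝ) / θ)).congr_deriv ?_
    field_simp
  · exact Continuous.intervalIntegrable (by fun_prop) _ _
  · intro s _
    refine ((hasDerivAt_expWeight θ s).mul
      (((hasDerivAt_id s).div_const θ).sub_const (1 / θ ^ 2))).congr_deriv ?_
    simp only [id]
    field_simp
    ring
  · exact Continuous.intervalIntegrable (by fun_prop) _ _

lemma memLp_expInt (hB : IsPreBrownianReal U P) (hc : ∀ ω, Continuous fun t => U t ω)
    (hm : ∀ t, Measurable (U t)) {θ : ℝ} (hθ : 0 ≤ θ) :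
    MemLp (fun ω => expInt θ (fun t => U t ω)) 2 P := by
  have hmeas := (measurable_expInt hc (fun t _ => hm t) θ)
  rw [memLp_two_iff_integrable_sq hmeas.aestronglyMeasurable]
  exact (memLp_two_sq_of_integrable_pow_four hmeas.aestronglyMeasurable
    (expInt_pow_four_moment hB hc hm hθ).1).integrable (by norm_num)

lemma integral_expInt_sq (hB : IsPreBrownianReal U P)
    (hc : ∀ ω, Continuous fun t => U t ω) (hm : ∀ t, Measurable (U t)) {θ : ℝ} (hθ : 0 < θ) :
    ∫ ω, expInt θ (fun t => U t ω) ^ 2 ∂P =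
      (θ - 3 / 2 + 2 * Real.exp (-θ) - Real.exp (-θ) ^ 2 / 2) / θ ^ 3 := by
  have h := integral_mul_expInt hB hc hm hθ.le (measurable_expInt hc (fun t _ => hm t) θ)
    (memLp_expInt hB hc hm hθ.le)
  rw [show (fun ω => expInt θ (fun t => U t ω) ^ 2) = fun ω => expInt θ (fun t => U t ω) *
    expInt θ (fun t => U t ω) from funext fun ω => sq _, h]
  have e : ∀ s ∈ Set.uIcc (0 : ℝ) 1, Real.exp (-θ * (1 - s)) *
      ∫ ω, expInt θ (fun t => U t ω) * U s.toNNReal ω ∂P = Real.exp (-θ * (1 - s)) *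
        (s / θ - (Real.exp (-θ * (1 - s)) - Real.exp (-θ)) / θ ^ 2) := fun s hs => by
    rw [Set.uIcc_of_le zero_le_one] at hs
    have h1 : s.toNNReal ≤ 1 := by simpa using hs.2
    have h2 := integral_eval_mul_expInt hB hc hm hθ h1
    rw [Real.coe_toNNReal s hs.1] at h2
    rw [← h2]
    congr 2; funext ω; ring
  rw [intervalIntegral.integral_congr e, intervalIntegral.integral_eq_sub_of_hasDerivAt
    (f := fun s => Real.exp (-θ * (1 - s)) * (s / θ ^ 2 - 1 / θ ^ 3 + Real.exp (-θ) / θ ^ 3 -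
      Real.exp (-θ * (1 - s)) / (2 * θ ^ 3)))]
  · simp
    field_simp
    ring
  · intro s _
    refine ((hasDerivAt_expWeight θ s).mul (((((hasDerivAt_id s).div_const (θ ^ 2)).sub_const
      (1 / θ ^ 3)).add_const (Real.exp (-θ) / θ ^ 3)).sub
      ((hasDerivAt_expWeight θ s).div_const (2 * θ ^ 3)))).congr_deriv ?_
    simp only [id, Pi.sub_apply]
    field_simp
    ring
  · exact Continuous.intervalIntegrable (by fun_prop) _ _

end Moments


/-! ### Measurable versions with continuous paths -/

section Versions

variable {Ω : Type u} {mΩ : MeasurableSpace Ω} {P : Measure Ω}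

/-- Off a measurable null set the path is continuous and agrees with measurable versions at
countably many dense times; on that set the new process is zero. Measurability at other times
follows by taking limits. -/
lemma exists_continuous_version {B : ℝ≥0 → Ω → ℝ} (hm : ∀ t, AEMeasurable (B t) P)
    (hc : ∀ᵐ ω ∂P, Continuous fun t => B t ω) :
    ∃ B' : ℝ≥0 → Ω → ℝ, (∀ ω, Continuous fun t => B' t ω) ∧ (∀ t, Measurable (B' t)) ∧
      ∀ᵐ ω ∂P, ∀ t, B t ω = B' t ω := by
  classical
  set D := TopologicalSpace.denseSeq ℝ≥0
  have hae : ∀ᵐ ω ∂P, (Continuous fun t => B t ω) ∧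
      ∀ n, B (D n) ω = (hm (D n)).mk (B (D n)) ω :=
    hc.and (ae_all_iff.2 fun n => (hm (D n)).ae_eq_mk)
  set N := toMeasurable P {ω | ¬((Continuous fun t => B t ω) ∧
      ∀ n, B (D n) ω = (hm (D n)).mk (B (D n)) ω)} with hN
  have hN0 : P N = 0 := by rw [hN, measure_toMeasurable]; exact hae
  have hNmeas : MeasurableSet N := measurableSet_toMeasurable _ _
  have hgood : ∀ ω, ω ∉ N → (Continuous fun t => B t ω) ∧
      ∀ n, B (D n) ω = (hm (D n)).mk (B (D n)) ω := fun ω hω => by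
    by_contra h
    exact hω (subset_toMeasurable _ _ h)
  refine ⟨fun t => Nᶜ.indicator (B t), fun ω => ?_, fun t => ?_, ?_⟩
  · by_cases hω : ω ∈ N
    · simp [hω, continuous_const]
    · simpa [hω] using (hgood ω hω).1
  · obtain ⟨x, hx, hlim⟩ := mem_closure_iff_seq_limit.1
      ((TopologicalSpace.denseRange_denseSeq ℝ≥0) t)
    choose k hk using hx
    refine measurable_of_tendsto_metrizable (f := fun j => Nᶜ.indicator ((hm (D (k j))).mk _))
      (fun j => (hm (D (k j))).measurable_mk.indicator hNmeas.compl) ?_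
    rw [tendsto_pi_nhds]
    intro ω
    by_cases hω : ω ∈ N
    · simp [hω]
    · have h1 := (((hgood ω hω).1.tendsto t).comp hlim)
      have h2 : ∀ j, Nᶜ.indicator ((hm (D (k j))).mk (B (D (k j)))) ω = B (x j) ω := fun j => by
        rw [Set.indicator_of_mem (by simpa using hω), ← (hgood ω hω).2, ← hk]
      simp only [h2]
      rw [Set.indicator_of_mem (by simpa using hω)]
      exact h1
  · have : ∀ᵐ ω ∂P, ω ∉ N := measure_eq_zero_iff_ae_notMem.1 hN0
    filter_upwards [this] with ω hω t
    rw [Set.indicator_of_mem (by simpa using hω)]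

end Versions

/-! ### Regrouping independent σ-algebras -/

section Independence

variable {Ω : Type u} {mΩ : MeasurableSpace Ω} {P : Measure Ω} [IsProbabilityMeasure P]

/-- On the π-system of sets `s ∩ t` generating the supremum, `P(s ∩ t ∩ u)` factors by taking out
`s` first, then `t`. -/
lemma indep_sup_left {m₁ m₂ m₃ : MeasurableSpace Ω} (h₁ : m₁ ≤ mΩ) (h₂ : m₂ ≤ mΩ) (h₃ : m₃ ≤ mΩ)
    (h : Indep m₁ (m₂ ⊔ m₃) P) (h' : Indep m₂ m₃ P) : Indep (m₁ ⊔ m₂) m₃ P := by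
  rw [Indep_iff] at h h'
  refine IndepSets.indep (p1 := Set.image2 (· ∩ ·) {s | MeasurableSet[m₁] s}
    {t | MeasurableSet[m₂] t}) (p2 := {t | MeasurableSet[m₃] t}) (sup_le h₁ h₂) h₃ ?_
    (@MeasurableSpace.isPiSystem_measurableSet Ω m₃) ?_
    (@MeasurableSpace.generateFrom_measurableSet Ω m₃).symm ?_
  · rintro _ ⟨s, hs, t, ht, rfl⟩ _ ⟨s', hs', t', ht', rfl⟩ _
    exact ⟨s ∩ s', hs.inter hs', t ∩ t', ht.inter ht', Set.inter_inter_inter_comm _ _ _ _⟩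
  · apply le_antisymm
    · refine sup_le (fun s hs => ?_) (fun t ht => ?_)
      · exact MeasurableSpace.measurableSet_generateFrom
          ⟨s, hs, Set.univ, MeasurableSet.univ, Set.inter_univ s⟩
      · exact MeasurableSpace.measurableSet_generateFrom
          ⟨Set.univ, MeasurableSet.univ, t, ht, Set.univ_inter t⟩
    · apply MeasurableSpace.generateFrom_le
      rintro _ ⟨s, hs, t, ht, rfl⟩
      exact (le_sup_left (a := m₁) (b := m₂) s hs).inter (le_sup_right (a := m₁) (b := m₂) t ht)
  · rw [IndepSets_iff]
    rintro _ u ⟨s, hs, t, ht, rfl⟩ hu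
    have ht' := le_sup_left (a := m₂) (b := m₃) t ht
    have hu' := le_sup_right (a := m₂) (b := m₃) u hu
    change P (s ∩ t ∩ u) = P (s ∩ t) * P u
    rw [Set.inter_assoc, h s (t ∩ u) hs (ht'.inter hu'), h s t hs ht', h' t u ht hu, mul_assoc]

/-- If two σ-algebras are independent and each contains an independent pair, then the pairs can be
regrouped. -/
lemma indep_sup_sup {m₁ m₂ n₁ n₂ : MeasurableSpace Ω} (h₁ : m₁ ≤ mΩ) (h₂ : m₂ ≤ mΩ)
    (k₁ : n₁ ≤ mΩ) (k₂ : n₂ ≤ mΩ) (h : Indep (m₁ ⊔ m₂) (n₁ ⊔ n₂) P) (hm : Indep m₁ m₂ P)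
    (hn : Indep n₁ n₂ P) : Indep (m₁ ⊔ n₁) (m₂ ⊔ n₂) P := by
  have e₁ : Indep m₂ (m₁ ⊔ (n₁ ⊔ n₂)) P := by
    have := indep_sup_left (sup_le k₁ k₂) h₁ h₂ h.symm hm
    rw [sup_comm] at this
    exact this.symm
  have e₃ : Indep (m₁ ⊔ n₁) n₂ P :=
    indep_sup_left h₁ k₁ k₂ (indep_of_indep_of_le_left h le_sup_left) hn
  have e₄ : Indep m₂ ((m₁ ⊔ n₁) ⊔ n₂) P := by rwa [sup_assoc]
  have e₅ : Indep (m₂ ⊔ n₂) (m₁ ⊔ n₁) P := by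
    refine indep_sup_left h₂ k₂ (sup_le h₁ k₁) ?_ e₃.symm
    rwa [sup_comm n₂]
  exact e₅.symm

end Independence

/-- The driving noises and the initial value, realized by measurable processes with continuous
paths. -/
structure IsNoise {Ω : Type u} [MeasurableSpace Ω] (P : Measure Ω) (d : ℝ)
    (W V : ℝ≥0 → Ω → ℝ) (ξ : Ω → ℝ) : Prop where
  preBrownian_W : IsPreBrownianReal W P
  preBrownian_V : IsPreBrownianReal V P
  law_init : HasLaw ξ (gaussianReal 0 (d ^ 2).toNNReal) P
  indep_noises : IndepFun (fun ω t => V t ω) (fun ω t => W t ω) P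
  indep_init : IndepFun ξ (fun ω => ((fun t => W t ω), (fun t => V t ω))) P
  continuous_V : ∀ ω, Continuous fun t => V t ω
  measurable_W : ∀ t, Measurable (W t)
  measurable_V : ∀ t, Measurable (V t)
  measurable_init : Measurable ξ

/-! ### The discrete-time innovations and their moments -/

section Noise

variable {Ω : Type u} {mΩ : MeasurableSpace Ω}

/-- The σ-algebra generated by a process. -/
abbrev pathSigma (B : ℝ≥0 → Ω → ℝ) : MeasurableSpace Ω :=
  MeasurableSpace.comap (fun ω t => B t ω) inferInstance

lemma measurable_pathSigma (B : ℝ≥0 → Ω → ℝ) (s : ℝ≥0) : Measurable[pathSigma B] (B s) :=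
  (measurable_pi_apply s).comp (comap_measurable (fun ω t => B t ω))

/-- The σ-algebra generated by a process up to time `t`. -/
abbrev pastOf (B : ℝ≥0 → Ω → ℝ) (t : ℝ≥0) : MeasurableSpace Ω :=
  MeasurableSpace.comap (fun ω (s : Set.Iic t) => B s ω) inferInstance

/-- The σ-algebra generated by the increments of a process after time `t`. -/
abbrev futureOf (B : ℝ≥0 → Ω → ℝ) (t : ℝ≥0) : MeasurableSpace Ω :=
  MeasurableSpace.comap (fun ω (s : ℝ≥0) => B (t + s) ω - B t ω) inferInstance

lemma measurable_pastOf {B : ℝ≥0 → Ω → ℝ} {s t : ℝ≥0} (h : s ≤ t) :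
    Measurable[pastOf B t] (B s) :=
  (measurable_pi_apply (⟨s, h⟩ : Set.Iic t)).comp
    (comap_measurable (fun ω (s : Set.Iic t) => B s ω))

lemma measurable_futureOf {B : ℝ≥0 → Ω → ℝ} (s t : ℝ≥0) :
    Measurable[futureOf B t] (fun ω => B (t + s) ω - B t ω) :=
  (measurable_pi_apply s).comp (comap_measurable (fun ω (s : ℝ≥0) => B (t + s) ω - B t ω))

lemma pastOf_le_iff {B : ℝ≥0 → Ω → ℝ} {t : ℝ≥0} {m : MeasurableSpace Ω} :
    pastOf B t ≤ m ↔ ∀ s ≤ t, Measurable[m] (B s) := by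
  rw [pastOf, ← measurable_iff_comap_le, measurable_pi_iff]
  exact ⟨fun h s hs => h ⟨s, hs⟩, fun h s => h s s.2⟩

lemma futureOf_le_iff {B : ℝ≥0 → Ω → ℝ} {t : ℝ≥0} {m : MeasurableSpace Ω} :
    futureOf B t ≤ m ↔ ∀ s, Measurable[m] (fun ω => B (t + s) ω - B t ω) := by
  rw [futureOf, ← measurable_iff_comap_le, measurable_pi_iff]

/-- The information on the initial value and the noises up to time `n`. -/
abbrev history (W V : ℝ≥0 → Ω → ℝ) (ξ : Ω → ℝ) (n : ℕ) : MeasurableSpace Ω :=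
  MeasurableSpace.comap ξ inferInstance ⊔ (pastOf V n ⊔ pastOf W n)

/-- The weighted integral of the increments of `V` over `[n, n + 1]`. -/
noncomputable def noiseInt (V : ℝ≥0 → Ω → ℝ) (θ : ℝ) (n : ℕ) (ω : Ω) : ℝ :=
  expInt θ (fun t => V (n + t) ω - V n ω)

lemma measurable_noiseInt {m : MeasurableSpace Ω} {V : ℝ≥0 → Ω → ℝ}
    (hc : ∀ ω, Continuous fun t => V t ω) (θ : ℝ) (n : ℕ)
    (hm : ∀ t ≤ 1, Measurable[m] fun ω => V (n + t) ω - V n ω) :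
    Measurable[m] (noiseInt V θ n) :=
  measurable_expInt (U := fun t ω => V (n + t) ω - V n ω)
    (fun ω => ((hc ω).comp (by fun_prop)).sub continuous_const) hm θ

/-- The innovation of the autoregression `Y_{n+1} = e^{-θ} Y_n + η_n`. -/
noncomputable def stateNoise (V : ℝ≥0 → Ω → ℝ) (b θ : ℝ) (n : ℕ) (ω : Ω) : ℝ :=
  b * (V (n + 1) ω - V n ω - θ * noiseInt V θ n ω)

/-- The part of `X_{n+1} - X_n` that is independent of the history. -/
noncomputable def obsNoise (W V : ℝ≥0 → Ω → ℝ) (a b σ θ : ℝ) (n : ℕ) (ω : Ω) : ℝ :=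
  a * b * noiseInt V θ n ω + σ * (W (n + 1) ω - W n ω)

/-- The hidden process at integer times. -/
noncomputable def state (V : ℝ≥0 → Ω → ℝ) (ξ : Ω → ℝ) (b θ : ℝ) : ℕ → Ω → ℝ
  | 0 => ξ
  | n + 1 => fun ω => Real.exp (-θ) * state V ξ b θ n ω + stateNoise V b θ n ω

namespace IsNoise

variable {P : Measure Ω} {d : ℝ} {W V : ℝ≥0 → Ω → ℝ} {ξ : Ω → ℝ}

lemma history_mono (W V : ℝ≥0 → Ω → ℝ) (ξ : Ω → ℝ) : Monotone (history W V ξ) := by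
  intro n m hnm
  have hnm' : (n : ℝ≥0) ≤ m := by exact_mod_cast hnm
  exact sup_le_sup le_rfl (sup_le_sup
    (pastOf_le_iff.2 fun s hs => measurable_pastOf (hs.trans hnm'))
    (pastOf_le_iff.2 fun s hs => measurable_pastOf (hs.trans hnm')))

lemma history_le (h : IsNoise P d W V ξ) (n : ℕ) : history W V ξ n ≤ mΩ :=
  sup_le h.measurable_init.comap_le (sup_le (pastOf_le_iff.2 fun s _ => h.measurable_V s)
    (pastOf_le_iff.2 fun s _ => h.measurable_W s))

lemma measurable_V_history {n : ℕ} {s : ℝ≥0} (hs : s ≤ n) :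
    Measurable[history W V ξ n] (V s) :=
  (measurable_pastOf hs).mono (le_sup_left.trans le_sup_right) le_rfl

lemma measurable_W_history {n : ℕ} {s : ℝ≥0} (hs : s ≤ n) :
    Measurable[history W V ξ n] (W s) :=
  (measurable_pastOf hs).mono (le_sup_right.trans le_sup_right) le_rfl

lemma measurable_noiseInt_history (h : IsNoise P d W V ξ) (θ : ℝ) (n : ℕ) :
    Measurable[history W V ξ (n + 1)] (noiseInt V θ n) := by
  refine measurable_noiseInt h.continuous_V θ n fun t ht => ?_
  exact (measurable_V_history (by push_cast; gcongr)).sub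
    (measurable_V_history (by push_cast; exact le_self_add))

lemma measurable_stateNoise (h : IsNoise P d W V ξ) (b θ : ℝ) (n : ℕ) :
    Measurable[history W V ξ (n + 1)] (stateNoise V b θ n) := by
  have h1 := h.measurable_noiseInt_history θ n
  have h2 : Measurable[history W V ξ (n + 1)] (V (n + 1)) := measurable_V_history (by simp)
  have h3 : Measurable[history W V ξ (n + 1)] (V n) := measurable_V_history (by simp)
  exact ((h2.sub h3).sub (h1.const_mul θ)).const_mul b

lemma measurable_obsNoise (h : IsNoise P d W V ξ) (a b σ θ : ℝ) (n : ℕ) :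
    Measurable[history W V ξ (n + 1)] (obsNoise W V a b σ θ n) := by
  have h1 := h.measurable_noiseInt_history θ n
  have h2 : Measurable[history W V ξ (n + 1)] (W (n + 1)) := measurable_W_history (by simp)
  have h3 : Measurable[history W V ξ (n + 1)] (W n) := measurable_W_history (by simp)
  exact (h1.const_mul (a * b)).add ((h2.sub h3).const_mul σ)

/-- Each Brownian motion has future increments independent of its past. Independence of `V` and `W`
lets the two pasts and the two futures be regrouped, and `ξ`, independent of everything else, joins
the past. -/
lemma indep_history_future [IsProbabilityMeasure P] (h : IsNoise P d W V ξ) (n : ℕ) :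
    Indep (history W V ξ n) (futureOf V n ⊔ futureOf W n) P := by
  have eV := measurable_pathSigma V
  have eW := measurable_pathSigma W
  have pV : pastOf V n ≤ pathSigma V := pastOf_le_iff.2 fun s _ => eV s
  have pW : pastOf W n ≤ pathSigma W := pastOf_le_iff.2 fun s _ => eW s
  have fV : futureOf V n ≤ pathSigma V := futureOf_le_iff.2 fun s => (eV _).sub (eV _)
  have fW : futureOf W n ≤ pathSigma W := futureOf_le_iff.2 fun s => (eW _).sub (eW _)
  have hV : pathSigma V ≤ mΩ := (measurable_pi_iff.2 h.measurable_V).comap_le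
  have hW : pathSigma W ≤ mΩ := (measurable_pi_iff.2 h.measurable_W).comap_le
  have iVW : Indep (pathSigma V) (pathSigma W) P := (IndepFun_iff_Indep _ _ _).1 h.indep_noises
  have iξ : Indep (MeasurableSpace.comap ξ inferInstance) (pathSigma V ⊔ pathSigma W) P := by
    have h1 := (IndepFun_iff_Indep _ _ _).1 h.indep_init
    refine indep_of_indep_of_le_right h1 (sup_le ?_ ?_)
    · exact (measurable_snd.comp (comap_measurable
        (fun ω => ((fun t => W t ω), (fun t => V t ω))))).comap_le
    · exact (measurable_fst.comp (comap_measurable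
        (fun ω => ((fun t => W t ω), (fun t => V t ω))))).comap_le
  have iV : Indep (pastOf V n) (futureOf V n) P :=
    ((IndepFun_iff_Indep _ _ _).1 (h.preBrownian_V.indepFun_shift n)).symm
  have iW : Indep (pastOf W n) (futureOf W n) P :=
    ((IndepFun_iff_Indep _ _ _).1 (h.preBrownian_W.indepFun_shift n)).symm
  have key : Indep (pastOf V n ⊔ pastOf W n) (futureOf V n ⊔ futureOf W n) P := by
    refine indep_sup_sup (pV.trans hV) (fV.trans hV) (pW.trans hW) (fW.trans hW) ?_ iV iW
    exact indep_of_indep_of_le_left (indep_of_indep_of_le_right iVW (sup_le pW fW))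
      (sup_le pV fV)
  refine indep_sup_left h.measurable_init.comap_le
    (sup_le (pV.trans hV) (pW.trans hW)) (sup_le (fV.trans hV) (fW.trans hW)) ?_ key
  exact indep_of_indep_of_le_right iξ
    (sup_le (sup_le_sup pV pW) (sup_le_sup fV fW))

lemma indep_history [IsProbabilityMeasure P] (h : IsNoise P d W V ξ) (a b σ θ : ℝ) (n : ℕ) :
    Indep (history W V ξ n) (MeasurableSpace.comap
      (fun ω => (stateNoise V b θ n ω, obsNoise W V a b σ θ n ω)) inferInstance) P := by
  refine indep_of_indep_of_le_right (h.indep_history_future n) ?_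
  have h1 : Measurable[futureOf V n ⊔ futureOf W n] (noiseInt V θ n) :=
    measurable_noiseInt h.continuous_V θ n fun t _ => (measurable_futureOf t n).mono le_sup_left le_rfl
  have h2 : Measurable[futureOf V n ⊔ futureOf W n] (fun ω => V (n + 1) ω - V n ω) :=
    (measurable_futureOf 1 n).mono le_sup_left le_rfl
  have h3 : Measurable[futureOf V n ⊔ futureOf W n] (fun ω => W (n + 1) ω - W n ω) :=
    (measurable_futureOf 1 n).mono le_sup_right le_rfl
  exact (((h2.sub (h1.const_mul θ)).const_mul b).prodMk
    ((h1.const_mul (a * b)).add (h3.const_mul σ))).comap_le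

/-- The increments after time `n` form another Brownian motion, which reduces all cases to the first
unit interval. -/
lemma noiseInt_moments [IsProbabilityMeasure P] (h : IsNoise P d W V ξ) {θ : ℝ} (hθ : 0 < θ) (n : ℕ) :
    MemLp (noiseInt V θ n) 2 P ∧ ∫ ω, noiseInt V θ n ω ∂P = 0 ∧
    ∫ ω, noiseInt V θ n ω ^ 2 ∂P =
      (θ - 3 / 2 + 2 * Real.exp (-θ) - Real.exp (-θ) ^ 2 / 2) / θ ^ 3 ∧
    ∫ ω, (V (n + 1) ω - V n ω) * noiseInt V θ n ω ∂P =
      1 / θ - (1 - Real.exp (-θ)) / θ ^ 2 ∧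
    Integrable (fun ω => noiseInt V θ n ω ^ 4) P ∧
    ∫ ω, noiseInt V θ n ω ^ 4 ∂P ≤ normalFourthMoment := by
  have hB := h.preBrownian_V.shift n
  have hc : ∀ ω, Continuous fun t => V (n + t) ω - V n ω :=
    fun ω => ((h.continuous_V ω).comp (by fun_prop)).sub continuous_const
  have hm : ∀ t : ℝ≥0, Measurable fun ω => V (n + t) ω - V n ω :=
    fun t => (h.measurable_V _).sub (h.measurable_V _)
  refine ⟨memLp_expInt hB hc hm hθ.le, integral_expInt hB hc hm hθ.le,
    integral_expInt_sq hB hc hm hθ, ?_, (expInt_pow_four_moment hB hc hm hθ.le).1,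
    (expInt_pow_four_moment hB hc hm hθ.le).2⟩
  have := integral_eval_mul_expInt hB hc hm hθ (t := 1) le_rfl
  simpa [noiseInt] using this

lemma indepFun_noiseInt_W (h : IsNoise P d W V ξ) (θ : ℝ) (n : ℕ) :
    IndepFun (noiseInt V θ n) (fun ω => W (n + 1) ω - W n ω) P := by
  rw [IndepFun_iff_Indep]
  have h1 := (IndepFun_iff_Indep _ _ _).1 h.indep_noises
  have eV := measurable_pathSigma V
  have eW := measurable_pathSigma W
  exact indep_of_indep_of_le_left (indep_of_indep_of_le_right h1 ((eW _).sub (eW _)).comap_le)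
    (measurable_noiseInt h.continuous_V θ n fun t _ => (eV _).sub (eV _)).comap_le

end IsNoise

lemma add_pow_four_le (x y : ℝ) : (x + y) ^ 4 ≤ 8 * (x ^ 4 + y ^ 4) := by
  nlinarith [sq_nonneg (x - y), sq_nonneg (x ^ 2 - y ^ 2), sq_nonneg (x + y),
    mul_nonneg (sq_nonneg (x - y)) (sq_nonneg (x + y)), mul_nonneg (sq_nonneg (x - y))
    (sq_nonneg x), mul_nonneg (sq_nonneg (x - y)) (sq_nonneg y), sq_nonneg ((x - y) ^ 2)]

lemma integral_linear_pow_four_le {P : Measure Ω} {f g : Ω → ℝ} (hf : Measurable f)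
    (hg : Measurable g)
    (hf4 : Integrable (fun ω => f ω ^ 4) P) (hg4 : Integrable (fun ω => g ω ^ 4) P) {m : ℝ}
    (hfm : ∫ ω, f ω ^ 4 ∂P ≤ m) (hgm : ∫ ω, g ω ^ 4 ∂P ≤ m) (x y : ℝ) :
    Integrable (fun ω => (x * f ω + y * g ω) ^ 4) P ∧
    ∫ ω, (x * f ω + y * g ω) ^ 4 ∂P ≤ 8 * (x ^ 4 + y ^ 4) * m := by
  have hle : ∀ ω, (x * f ω + y * g ω) ^ 4 ≤ 8 * x ^ 4 * f ω ^ 4 + 8 * y ^ 4 * g ω ^ 4 := fun ω =>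
    (add_pow_four_le _ _).trans_eq (by ring)
  have hi := (hf4.const_mul (8 * x ^ 4)).fun_add (hg4.const_mul (8 * y ^ 4))
  have hi' : Integrable (fun ω => (x * f ω + y * g ω) ^ 4) P := by
    refine hi.mono' (((hf.const_mul x).add (hg.const_mul y)).pow_const 4).aestronglyMeasurable
      (ae_of_all _ fun ω => ?_)
    rw [Real.norm_of_nonneg (by positivity)]
    exact hle ω
  refine ⟨hi', (integral_mono hi' hi hle).trans ?_⟩
  rw [integral_add (hf4.const_mul _) (hg4.const_mul _), integral_const_mul, integral_const_mul]
  calc _ ≤ 8 * x ^ 4 * m + 8 * y ^ 4 * m := by gcongr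
    _ = _ := by ring

/-- A bound, uniform in the parameter, for the fourth moments. -/
noncomputable def momentBound (a b σ d α β : ℝ) : ℝ :=
  (d ^ 4 + 8 * b ^ 4 * (1 + β ^ 4) / (1 - Real.exp (-α)) ^ 4 + 8 * (a ^ 4 * b ^ 4 + σ ^ 4)) *
    normalFourthMoment

namespace IsNoise

variable {P : Measure Ω} {d : ℝ} {W V : ℝ≥0 → Ω → ℝ} {ξ : Ω → ℝ}

lemma hasLaw_increment {B : ℝ≥0 → Ω → ℝ} (hB : IsPreBrownianReal B P) (n : ℕ) :
    HasLaw (fun ω => B (n + 1) ω - B n ω) (gaussianReal 0 1) P :=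
  (hB.shift n).hasLaw_eval 1

variable [IsProbabilityMeasure P]

/-- By parts, the innovation is `b ∫ e^{-θ(1-s)} dV_s`. The value predicted by the Itô isometry is
recovered by expanding the square. -/
lemma integral_stateNoise_sq (h : IsNoise P d W V ξ) (b : ℝ) {θ : ℝ} (hθ : 0 < θ) (n : ℕ) :
    ∫ ω, stateNoise V b θ n ω ^ 2 ∂P = b ^ 2 * (1 - Real.exp (-θ) ^ 2) / (2 * θ) := by
  obtain ⟨hJ2, -, hsq, hcross, -, -⟩ := h.noiseInt_moments hθ n
  have hlaw := hasLaw_increment h.preBrownian_V n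
  have hu := hlaw.hasGaussianLaw.memLp_two
  have i1 := hu.integrable_sq
  have i2 : Integrable (fun ω => (V (n + 1) ω - V n ω) * noiseInt V θ n ω) P :=
    hu.integrable_mul hJ2
  have i3 := hJ2.integrable_sq
  have e : ∀ ω, stateNoise V b θ n ω ^ 2 = b ^ 2 * (V (n + 1) ω - V n ω) ^ 2 +
      -(2 * b ^ 2 * θ) * ((V (n + 1) ω - V n ω) * noiseInt V θ n ω) +
      b ^ 2 * θ ^ 2 * noiseInt V θ n ω ^ 2 := fun ω => by unfold stateNoise; ring
  simp_rw [e]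
  rw [integral_add ((i1.const_mul _).fun_add (i2.const_mul _)) (i3.const_mul _),
    integral_add (i1.const_mul _) (i2.const_mul _), integral_const_mul, integral_const_mul,
    integral_const_mul, hsq, hcross, hlaw.integral_sq_of_gaussianReal]
  simp only [NNReal.coe_one]
  field_simp
  ring

lemma integral_obsNoise_sq (h : IsNoise P d W V ξ) (a b σ : ℝ) {θ : ℝ} (hθ : 0 < θ) (n : ℕ) :
    ∫ ω, obsNoise W V a b σ θ n ω ^ 2 ∂P = a ^ 2 * b ^ 2 *
      ((θ - 3 / 2 + 2 * Real.exp (-θ) - Real.exp (-θ) ^ 2 / 2) / θ ^ 3) + σ ^ 2 := by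
  obtain ⟨hJ2, hJ, hsq, -, -, -⟩ := h.noiseInt_moments hθ n
  have hlaw := hasLaw_increment h.preBrownian_W n
  have hw := hlaw.hasGaussianLaw.memLp_two
  have i1 := hJ2.integrable_sq
  have i2 : Integrable (fun ω => noiseInt V θ n ω * (W (n + 1) ω - W n ω)) P :=
    hJ2.integrable_mul hw
  have i3 := hw.integrable_sq
  have hcross : ∫ ω, noiseInt V θ n ω * (W (n + 1) ω - W n ω) ∂P = 0 := by
    rw [(h.indepFun_noiseInt_W θ n).integral_fun_mul_eq_mul_integral hJ2.1 hw.1, hJ, zero_mul]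
  have e : ∀ ω, obsNoise W V a b σ θ n ω ^ 2 = a ^ 2 * b ^ 2 * noiseInt V θ n ω ^ 2 +
      2 * a * b * σ * (noiseInt V θ n ω * (W (n + 1) ω - W n ω)) +
      σ ^ 2 * (W (n + 1) ω - W n ω) ^ 2 := fun ω => by unfold obsNoise; ring
  simp_rw [e]
  rw [integral_add ((i1.const_mul _).fun_add (i2.const_mul _)) (i3.const_mul _),
    integral_add (i1.const_mul _) (i2.const_mul _), integral_const_mul, integral_const_mul,
    integral_const_mul, hsq, hcross, hlaw.integral_sq_of_gaussianReal]
  simp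

/-- The three summands of `momentBound` serve `ξ`, the state noise and the observation noise.
Dividing the second by `(1 - e^{-α})⁴` pays for the factor `(1 - ρ)⁴`, since `ρ ≤ e^{-α}`. -/
theorem isAutoregression (h : IsNoise P d W V ξ) (a b σ : ℝ) {α β θ : ℝ} (hα : 0 < α)
    (hθ : θ ∈ Set.Icc α β) :
    IsAutoregression P (history W V ξ) (state V ξ b θ) (stateNoise V b θ)
      (obsNoise W V a b σ θ) (Real.exp (-θ)) (b ^ 2 * (1 - Real.exp (-θ) ^ 2) / (2 * θ))
      (a ^ 2 * b ^ 2 * ((θ - 3 / 2 + 2 * Real.exp (-θ) - Real.exp (-θ) ^ 2 / 2) / θ ^ 3) +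
        σ ^ 2) (momentBound a b σ d α β) := by
  have hθ0 : 0 < θ := hα.trans_le hθ.1
  have hβ0 : 0 < β := hθ0.trans_le hθ.2
  have hm0 := normalFourthMoment_nonneg
  have hlV := hasLaw_increment h.preBrownian_V
  have hlW := hasLaw_increment h.preBrownian_W
  have mV : ∀ n : ℕ, Measurable fun ω => V (n + 1) ω - V n ω :=
    fun n => (h.measurable_V _).sub (h.measurable_V _)
  have mW : ∀ n : ℕ, Measurable fun ω => W (n + 1) ω - W n ω :=
    fun n => (h.measurable_W _).sub (h.measurable_W _)
  have mJ : ∀ n, Measurable (noiseInt V θ n) := fun n =>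
    measurable_noiseInt h.continuous_V θ n fun t _ => (h.measurable_V _).sub (h.measurable_V _)
  have hV4 : ∀ n : ℕ, ∫ ω, (V (n + 1) ω - V n ω) ^ 4 ∂P ≤ normalFourthMoment := fun n => by
    rw [(hlV n).integral_pow_four_of_gaussianReal]; simp
  have hW4 : ∀ n : ℕ, ∫ ω, (W (n + 1) ω - W n ω) ^ 4 ∂P ≤ normalFourthMoment := fun n => by
    rw [(hlW n).integral_pow_four_of_gaussianReal]; simp
  have hη4 : ∀ n, Integrable (fun ω => stateNoise V b θ n ω ^ 4) P ∧
      ∫ ω, stateNoise V b θ n ω ^ 4 ∂P ≤ 8 * (b ^ 4 + (-(b * θ)) ^ 4) * normalFourthMoment :=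
    fun n => by
      obtain ⟨-, -, -, -, hJ4, hJ4'⟩ := h.noiseInt_moments hθ0 n
      have e : stateNoise V b θ n =
          fun ω => b * (V (n + 1) ω - V n ω) + -(b * θ) * noiseInt V θ n ω := by
        funext ω; unfold stateNoise; ring
      rw [e]
      exact integral_linear_pow_four_le (mV n) (mJ n) (hlV n).integrable_pow_four_of_gaussianReal
        hJ4 (hV4 n) hJ4' b (-(b * θ))
  have hε4 : ∀ n, Integrable (fun ω => obsNoise W V a b σ θ n ω ^ 4) P ∧
      ∫ ω, obsNoise W V a b σ θ n ω ^ 4 ∂P ≤ 8 * ((a * b) ^ 4 + σ ^ 4) * normalFourthMoment :=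
    fun n => by
      obtain ⟨-, -, -, -, hJ4, hJ4'⟩ := h.noiseInt_moments hθ0 n
      exact integral_linear_pow_four_le (mJ n) (mW n) hJ4
        (hlW n).integrable_pow_four_of_gaussianReal hJ4' (hW4 n) (a * b) σ
  have hρα : Real.exp (-θ) ≤ Real.exp (-α) := Real.exp_le_exp.2 (neg_le_neg hθ.1)
  have hα1 : 0 < 1 - Real.exp (-α) := by
    rw [sub_pos, Real.exp_lt_one_iff]; linarith
  exact
  { mono := history_mono W V ξ
    le := h.history_le
    measurable_init := (comap_measurable ξ).mono le_sup_left le_rfl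
    measurable_eta := h.measurable_stateNoise b θ
    measurable_eps := h.measurable_obsNoise a b σ θ
    indep := h.indep_history a b σ θ
    rec_eq := fun n ω => rfl
    rho_nonneg := (Real.exp_pos _).le
    rho_lt_one := by rw [Real.exp_lt_one_iff]; linarith
    integral_eta := fun n => by
      obtain ⟨hJ2, hJ, -, -, -, -⟩ := h.noiseInt_moments hθ0 n
      simp_rw [stateNoise]
      rw [integral_const_mul, integral_sub (hlV n).hasGaussianLaw.integrable
        ((hJ2.integrable (by norm_num)).const_mul θ), integral_const_mul, hJ,
        (hlV n).integral_eq_zero_of_gaussianReal]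
      simp
    integral_eps := fun n => by
      obtain ⟨hJ2, hJ, -, -, -, -⟩ := h.noiseInt_moments hθ0 n
      simp_rw [obsNoise]
      rw [integral_add ((hJ2.integrable (by norm_num)).const_mul _)
        ((hlW n).hasGaussianLaw.integrable.const_mul σ), integral_const_mul,
        integral_const_mul, hJ, (hlW n).integral_eq_zero_of_gaussianReal]
      simp
    integral_eta_sq := h.integral_stateNoise_sq b hθ0
    integral_eps_sq := h.integral_obsNoise_sq a b σ hθ0
    integrable_init := h.law_init.integrable_pow_four_of_gaussianReal
    integrable_eta := fun n => (hη4 n).1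
    integrable_eps := fun n => (hε4 n).1
    integral_init_le := by
      change ∫ ω, ξ ω ^ 4 ∂P ≤ _
      rw [h.law_init.integral_pow_four_of_gaussianReal, Real.coe_toNNReal _ (sq_nonneg d),
        momentBound]
      gcongr
      have : 0 ≤ 8 * b ^ 4 * (1 + β ^ 4) / (1 - Real.exp (-α)) ^ 4 := by positivity
      have : 0 ≤ 8 * (a ^ 4 * b ^ 4 + σ ^ 4) := by positivity
      linarith [show (d ^ 2) ^ 2 = d ^ 4 by ring]
    integral_eta_le := fun n => by
      refine (hη4 n).2.trans ?_
      rw [momentBound, ← mul_assoc]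
      refine mul_le_mul_of_nonneg_right ?_ hm0
      calc 8 * (b ^ 4 + (-(b * θ)) ^ 4) = 8 * b ^ 4 * (1 + θ ^ 4) := by ring
        _ ≤ 8 * b ^ 4 * (1 + β ^ 4) := by gcongr; exact hθ.2
        _ = (1 - Real.exp (-α)) ^ 4 *
            (8 * b ^ 4 * (1 + β ^ 4) / (1 - Real.exp (-α)) ^ 4) := by field_simp
        _ ≤ (1 - Real.exp (-θ)) ^ 4 * (d ^ 4 + 8 * b ^ 4 * (1 + β ^ 4) /
            (1 - Real.exp (-α)) ^ 4 + 8 * (a ^ 4 * b ^ 4 + σ ^ 4)) := by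
          have : 0 ≤ 8 * (a ^ 4 * b ^ 4 + σ ^ 4) := by positivity
          have : 0 ≤ d ^ 4 := by positivity
          have : 0 ≤ 8 * b ^ 4 * (1 + β ^ 4) / (1 - Real.exp (-α)) ^ 4 := by positivity
          gcongr
          linarith
    integral_eps_le := fun n => by
      refine (hε4 n).2.trans ?_
      rw [momentBound]
      refine mul_le_mul_of_nonneg_right ?_ hm0
      have : 0 ≤ d ^ 4 := by positivity
      have : 0 ≤ 8 * b ^ 4 * (1 + β ^ 4) / (1 - Real.exp (-α)) ^ 4 := by positivity
      linarith [show (a * b) ^ 4 = a ^ 4 * b ^ 4 by ring] }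

end IsNoise

end Noise


/-! ### From the continuous-time model to the autoregression -/

section Model

variable {Ω : Type u} {mΩ : MeasurableSpace Ω} {P : Measure Ω}
  {a b σ d θ : ℝ} {W V : ℝ≥0 → Ω → ℝ} {ξ : Ω → ℝ} {X Y : ℝ≥0 → Ω → ℝ}

/-- The increments of the observed process over unit intervals are an autoregression observed in
noise. -/
lemma IsModel.exists_isNoise (h : IsModel P a b σ d θ W V ξ X Y) (hθ : θ ≠ 0) :
    ∃ (W' V' : ℝ≥0 → Ω → ℝ) (ξ' : Ω → ℝ), IsNoise P d W' V' ξ' ∧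
      ∀ᵐ ω ∂P, ∀ k : ℕ, X ((k : ℝ≥0) + 1) ω - X k ω =
        a * (1 - Real.exp (-θ)) / θ * state V' ξ' b θ k ω + obsNoise W' V' a b σ θ k ω := by
  obtain ⟨W', -, mW, eW⟩ := exists_continuous_version
    (fun t => h.wiener_W.toIsPreBrownianReal.aemeasurable t) h.wiener_W.cont
  obtain ⟨V', cV, mV, eV⟩ := exists_continuous_version
    (fun t => h.wiener_V.toIsPreBrownianReal.aemeasurable t) h.wiener_V.cont
  have hξ := h.law_init.aemeasurable
  have eW' : (fun ω t => W t ω) =ᵐ[P] fun ω t => W' t ω := by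
    filter_upwards [eW] with ω hω using funext hω
  have eV' : (fun ω t => V t ω) =ᵐ[P] fun ω t => V' t ω := by
    filter_upwards [eV] with ω hω using funext hω
  refine ⟨W', V', hξ.mk ξ, ?_, ?_⟩
  · exact
    { preBrownian_W := h.wiener_W.toIsPreBrownianReal.congr
        fun t => eW.mono fun ω hω => hω t
      preBrownian_V := h.wiener_V.toIsPreBrownianReal.congr
        fun t => eV.mono fun ω hω => hω t
      law_init := h.law_init.congr hξ.ae_eq_mk.symm
      indep_noises := (h.indep_noises.congr eW' eV').symm
      indep_init := h.indep_init.congr hξ.ae_eq_mk (by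
        filter_upwards [eW', eV'] with ω h1 h2
        rw [h1, h2])
      continuous_V := cV
      measurable_W := mW
      measurable_V := mV
      measurable_init := hξ.measurable_mk }
  · filter_upwards [eW, eV, hξ.ae_eq_mk, h.continuous_Y, h.eq_Y, h.eq_X,
      h.wiener_V.eval_zero_ae_eq_zero] with ω hW hV hξω hcY hY hX hV0
    have hY' : ∀ t : ℝ≥0, Y t ω = hξ.mk ξ ω - θ * (∫ s in (0 : ℝ)..t, Y s.toNNReal ω) +
        b * V' t ω := fun t => by rw [hY t, hξω, hV]
    have hstep := linear_equation_step hcY (cV ω) hθ hY'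
    -- The case `k = 0` needs `V_0 = 0`, which holds almost surely.
    have hstate : ∀ k : ℕ, Y k ω = state V' (hξ.mk ξ) b θ k ω := by
      intro k
      induction k with
      | zero => simp [state, hY' 0, ← hV 0, hV0]
      | succ k ih =>
        push_cast
        rw [(hstep k).2, ih]
        rfl
    intro k
    have h1 := (hstep k).1
    rw [hX, hX, hW, hW, ← hstate, obsNoise, noiseInt]
    linear_combination a * h1

end Model

/-- A bound, uniform in the parameter, for `K` times the mean square of `S_K - Φ(θ)`. -/
noncomputable def errorBound (a b σ d α β : ℝ) : ℝ :=
  (52 * (a ^ 2 / (α ^ 2 * (1 - Real.exp (-α)))) ^ 2 + 32 * (a / α) ^ 2 + 16) *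
    momentBound a b σ d α β

/-- The stationary variance of the state is `q/(1 - ρ²) = b²/(2θ)`, so `l q = κ² b²/(2θ)`. Thus
`Φ(θ)` is the second moment of an observed increment in the stationary regime. -/
lemma Phi_eq_stationary {a b σ θ κ l : ℝ} (hθ : 0 < θ)
    (hκ : κ = a * (1 - Real.exp (-θ)) / θ) (hl : l * (1 - Real.exp (-θ) ^ 2) = κ ^ 2) :
    Phi a b σ θ = l * (b ^ 2 * (1 - Real.exp (-θ) ^ 2) / (2 * θ)) + (a ^ 2 * b ^ 2 *
      ((θ - 3 / 2 + 2 * Real.exp (-θ) - Real.exp (-θ) ^ 2 / 2) / θ ^ 3) + σ ^ 2) := by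
  have e : l * (b ^ 2 * (1 - Real.exp (-θ) ^ 2) / (2 * θ)) = κ ^ 2 * (b ^ 2 / (2 * θ)) := by
    rw [← hl]; ring
  rw [e, hκ, Phi]
  field_simp
  ring

/-! ### Mean-square error of the statistic and of the estimator -/

section Estimator

variable {Ω : Type u} {mΩ : MeasurableSpace Ω} {P : Measure Ω} [IsProbabilityMeasure P]
  {a b σ d α β θ : ℝ} {W V : ℝ≥0 → Ω → ℝ} {ξ : Ω → ℝ} {X Y : ℝ≥0 → Ω → ℝ}

lemma IsModel.integral_S_sub_sq_le (h : IsModel P a b σ d θ W V ξ X Y) (hα : 0 < α)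
    (hθ : θ ∈ Set.Icc α β) {K : ℕ} (hK : 1 ≤ K) :
    MemLp (fun ω => S X K ω - Phi a b σ θ) 2 P ∧
      ∫ ω, (S X K ω - Phi a b σ θ) ^ 2 ∂P ≤ errorBound a b σ d α β / K := by
  have hθ0 : 0 < θ := hα.trans_le hθ.1
  obtain ⟨W', V', ξ', hN, hinc⟩ := h.exists_isNoise hθ0.ne'
  have hAR := hN.isAutoregression a b σ hα hθ
  set ρ := Real.exp (-θ) with hρ
  have hρ0 : 0 < ρ := Real.exp_pos _
  have hρα : ρ ≤ Real.exp (-α) := Real.exp_le_exp.2 (neg_le_neg hθ.1)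
  have hα1 : 0 < 1 - Real.exp (-α) := by
    rw [sub_pos, Real.exp_lt_one_iff]; linarith
  have hρ1 : 0 < 1 - ρ := by linarith
  have hρ2 : 1 - ρ ≤ 1 - ρ ^ 2 := by nlinarith
  set κ := a * (1 - ρ) / θ with hκ
  set l := κ ^ 2 / (1 - ρ ^ 2) with hl
  have hl' : l * (1 - ρ ^ 2) = κ ^ 2 := div_mul_cancel₀ _ (by linarith)
  have hK0 : (0 : ℝ) < K := by exact_mod_cast hK
  obtain ⟨hmem, hint⟩ := hAR.integral_sum_sq_sub_sq_le hl' hK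
  rw [← Phi_eq_stationary hθ0 hκ hl'] at hmem hint
  have hκ2 : κ ^ 2 ≤ (a / α) ^ 2 := by
    rw [hκ, div_pow, div_pow, mul_pow]
    have : (1 - ρ) ^ 2 ≤ 1 := pow_le_one₀ hρ1.le (by linarith)
    gcongr
    · exact mul_le_of_le_one_right (sq_nonneg a) this
    · exact hθ.1
  have hl0 : 0 ≤ l := div_nonneg (sq_nonneg _) (by linarith)
  -- The denominator is bounded below uniformly: `1 - ρ² ≥ 1 - ρ ≥ 1 - e^{-α}`.
  have hlL : l ≤ a ^ 2 / (α ^ 2 * (1 - Real.exp (-α))) := by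
    rw [← div_div, ← div_pow]
    exact div_le_div₀ (sq_nonneg _) hκ2 hα1 (by linarith)
  have hconst : (52 * l ^ 2 + 32 * κ ^ 2 + 16) * momentBound a b σ d α β ≤
      errorBound a b σ d α β := by
    have := hAR.bound_nonneg
    unfold errorBound
    gcongr
  have hae : (fun ω => S X K ω - Phi a b σ θ) =ᵐ[P] fun ω => 1 / (K : ℝ) *
      ∑ k ∈ Finset.range K, ((κ * state V' ξ' b θ k ω + obsNoise W' V' a b σ θ k ω) ^ 2 -
        Phi a b σ θ) := by
    filter_upwards [hinc] with ω hω
    simp only [S, hω, Finset.sum_sub_distrib, Finset.sum_const, Finset.card_range, nsmul_eq_mul]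
    field_simp
  refine ⟨(memLp_congr_ae hae).2 (hmem.const_mul _), ?_⟩
  have hae2 : (fun ω => (S X K ω - Phi a b σ θ) ^ 2) =ᵐ[P] fun ω => (1 / (K : ℝ)) ^ 2 *
      (∑ k ∈ Finset.range K, ((κ * state V' ξ' b θ k ω + obsNoise W' V' a b σ θ k ω) ^ 2 -
        Phi a b σ θ)) ^ 2 := by
    filter_upwards [hae] with ω hω
    rw [hω, mul_pow]
  rw [integral_congr_ae hae2, integral_const_mul]
  calc _ ≤ (1 / (K : ℝ)) ^ 2 * (K * errorBound a b σ d α β) := by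
        refine mul_le_mul_of_nonneg_left (hint.trans ?_) (sq_nonneg _)
        gcongr
    _ = _ := by field_simp

lemma IsModel.integral_estimator_sub_sq_le (h : IsModel P a b σ d θ W V ξ X Y) (ha : a ≠ 0)
    (hb : b ≠ 0) (hα : 0 < α) (hαβ : α < β) (hθ : θ ∈ Set.Icc α β) {K : ℕ} (hK : 1 ≤ K) :
    MemLp (fun ω => estimator a b σ α β X K ω - θ) 2 P ∧
      ∫ ω, |estimator a b σ α β X K ω - θ| ^ 2 ∂P ≤
        errorBound a b σ d α β / slope a b β ^ 2 / K := by
  obtain ⟨hmem, hint⟩ := h.integral_S_sub_sq_le (β := β) hα hθ hK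
  have hs := slope_pos (a := a) (b := b) ha hb (hα.trans hαβ)
  have hle : ∀ ω, |estimator a b σ α β X K ω - θ| ≤
      |1 / slope a b β * (S X K ω - Phi a b σ θ)| := fun ω => by
    rw [abs_mul, abs_of_pos (one_div_pos.2 hs), one_div_mul_eq_div, le_div_iff₀' hs]
    exact slope_mul_abs_invert_sub_le ha hb hα hαβ hθ _
  -- The model does not require `X` to be measurable; a.e. measurability of `S_K` comes from its
  -- a.e. equality with the autoregressive sum, through `hmem`.
  have hSm : AEMeasurable (S X K) P := by
    have := hmem.aestronglyMeasurable.aemeasurable.add_const (Phi a b σ θ)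
    simpa using this
  have hmeas : AEStronglyMeasurable (fun ω => estimator a b σ α β X K ω - θ) P :=
    (((measurable_invert ha hb hα hαβ).comp_aemeasurable hSm).sub_const θ).aestronglyMeasurable
  have hL := hmem.const_mul (1 / slope a b β)
  have hE : MemLp (fun ω => estimator a b σ α β X K ω - θ) 2 P :=
    hL.mono hmeas (ae_of_all _ hle)
  refine ⟨hE, ?_⟩
  have i1 : Integrable (fun ω => |estimator a b σ α β X K ω - θ| ^ 2) P := by
    simpa only [sq_abs] using hE.integrable_sq
  calc ∫ ω, |estimator a b σ α β X K ω - θ| ^ 2 ∂P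
      ≤ ∫ ω, (1 / slope a b β * (S X K ω - Phi a b σ θ)) ^ 2 ∂P := by
        refine integral_mono i1 hL.integrable_sq fun ω => ?_
        simp only
        rw [← sq_abs (1 / slope a b β * _)]
        exact pow_le_pow_left₀ (abs_nonneg _) (hle ω) 2
    _ = (1 / slope a b β) ^ 2 * ∫ ω, (S X K ω - Phi a b σ θ) ^ 2 ∂P := by
        simp_rw [mul_pow]
        rw [integral_const_mul]
    _ ≤ (1 / slope a b β) ^ 2 * (errorBound a b σ d α β / K) := by gcongr
    _ = _ := by ring

end Estimator

end HiddenOU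

theorem proposition1 (a b σ d α β : ℝ) (ha : a ≠ 0) (hb : b ≠ 0) (hσ : σ ≠ 0)
    (hα : 0 < α) (hαβ : α < β) :
    -- `Φ` is strictly decreasing, and the estimator is well defined
    StrictAntiOn (HiddenOU.Phi a b σ) (Set.Icc α β) ∧
    (∀ s : ℝ, HiddenOU.Phi a b σ β < s → s < HiddenOU.Phi a b σ α →
      ∃! θ : ℝ, θ ∈ Set.Ioo α β ∧ HiddenOU.Phi a b σ θ = s) ∧
    -- consistency, uniformly on compacts
    (∀ α' β' : ℝ, Set.Icc α' β' ⊆ Set.Ioo α β → ∀ ε : ℝ, 0 < ε → ∀ η : ℝ, 0 < η →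
      ∃ K₀ : ℕ, ∀ K : ℕ, K₀ ≤ K → ∀ θ₀ ∈ Set.Icc α' β',
      ∀ (Ω : Type u) [MeasurableSpace Ω] (P : Measure Ω) [IsProbabilityMeasure P]
        (W V : ℝ≥0 → Ω → ℝ) (ξ : Ω → ℝ) (X Y : ℝ≥0 → Ω → ℝ),
        HiddenOU.IsModel P a b σ d θ₀ W V ξ X Y →
        P.real {ω | ε < |HiddenOU.estimator a b σ α β X K ω - θ₀|} ≤ η) ∧
    -- the bound on the mean square error, uniformly on the whole parameter set
    (∃ C : ℝ, 0 < C ∧ ∀ θ₀ ∈ Set.Ioo α β,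
      ∀ (Ω : Type u) [MeasurableSpace Ω] (P : Measure Ω) [IsProbabilityMeasure P]
        (W V : ℝ≥0 → Ω → ℝ) (ξ : Ω → ℝ) (X Y : ℝ≥0 → Ω → ℝ),
        HiddenOU.IsModel P a b σ d θ₀ W V ξ X Y →
        (∀ K : ℕ, 1 ≤ K →
          MemLp (fun ω => HiddenOU.estimator a b σ α β X K ω - θ₀) 2 P ∧
          ∫ ω, |HiddenOU.estimator a b σ α β X K ω - θ₀| ^ 2 ∂P ≤ C / K) ∧
        (∀ δ : ℝ, 1 / 2 < δ → δ < 1 → ∀ T : ℝ, 1 ≤ T →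
          ∫ ω, |HiddenOU.estimator a b σ α β X ⌊T ^ δ⌋₊ ω - θ₀| ^ 2 ∂P ≤ C * T ^ (-δ))) := by
  -- The maximum with 1 secures positivity without a lower bound on the moments.
  set C : ℝ := max (HiddenOU.errorBound a b σ d α β / HiddenOU.slope a b β ^ 2) 1 with hC
  have hC0 : 0 < C := lt_max_of_lt_right one_pos
  have main : ∀ θ₀ ∈ Set.Ioo α β, ∀ (Ω : Type u) [MeasurableSpace Ω] (P : Measure Ω)
      [IsProbabilityMeasure P] (W V : ℝ≥0 → Ω → ℝ) (ξ : Ω → ℝ) (X Y : ℝ≥0 → Ω → ℝ),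
      HiddenOU.IsModel P a b σ d θ₀ W V ξ X Y → ∀ K : ℕ, 1 ≤ K →
      MemLp (fun ω => HiddenOU.estimator a b σ α β X K ω - θ₀) 2 P ∧
      ∫ ω, |HiddenOU.estimator a b σ α β X K ω - θ₀| ^ 2 ∂P ≤ C / K := by
    intro θ₀ hθ₀ Ω _ P _ W V ξ X Y h K hK
    obtain ⟨h1, h2⟩ :=
      h.integral_estimator_sub_sq_le ha hb hα hαβ (Set.Ioo_subset_Icc_self hθ₀) hK
    refine ⟨h1, h2.trans ?_⟩
    gcongr
    exact le_max_left _ _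
  have hanti := HiddenOU.strictAntiOn_Phi (σ := σ) ha hb hα hαβ
  -- The factor 2 pays for the integer part in `K = ⌊T ^ δ⌋₊`.
  refine ⟨hanti, ?_, ?_, 2 * C, by positivity, ?_⟩
  · intro s h1 h2
    obtain ⟨θ, hθ, hs⟩ := HiddenOU.exists_Phi_eq hα hαβ h1 h2
    refine ⟨θ, ⟨hθ, hs⟩, fun θ' hθ' => ?_⟩
    exact hanti.injOn (Set.Ioo_subset_Icc_self hθ'.1) (Set.Ioo_subset_Icc_self hθ)
      (hθ'.2.trans hs.symm)
  · intro α' β' hsub ε hε η hη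
    -- Chebyshev bounds the probability by `C / (K ε²)`, which is at most `η` beyond this threshold.
    obtain ⟨K₀, hK₀⟩ := exists_nat_gt (C / (ε ^ 2 * η))
    refine ⟨K₀, fun K hK θ₀ hθ₀ Ω _ P _ W V ξ X Y h => ?_⟩
    have hK' : C / (ε ^ 2 * η) < K := hK₀.trans_le (by exact_mod_cast hK)
    have hK0 : (0 : ℝ) < K := lt_trans (by positivity) hK'
    obtain ⟨h1, h2⟩ := main θ₀ (hsub hθ₀) Ω P W V ξ X Y h K (by exact_mod_cast hK0)
    have hi : Integrable (fun ω => |HiddenOU.estimator a b σ α β X K ω - θ₀| ^ 2) P := by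
      simpa only [sq_abs] using h1.integrable_sq
    have hM := mul_meas_ge_le_integral_of_nonneg (μ := P)
      (f := fun ω => |HiddenOU.estimator a b σ α β X K ω - θ₀| ^ 2)
      (ae_of_all _ fun ω => by positivity) hi (ε ^ 2)
    have hsubset : P.real {ω | ε < |HiddenOU.estimator a b σ α β X K ω - θ₀|} ≤
        P.real {ω | ε ^ 2 ≤ |HiddenOU.estimator a b σ α β X K ω - θ₀| ^ 2} :=
      measureReal_mono fun ω hω => pow_le_pow_left₀ hε.le (le_of_lt hω) 2
    refine hsubset.trans ?_
    have h3 : C / K ≤ ε ^ 2 * η := by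
      rw [div_lt_iff₀ (by positivity)] at hK'
      rw [div_le_iff₀ hK0]
      linarith
    exact le_of_mul_le_mul_left (hM.trans (h2.trans h3)) (by positivity)
  · intro θ₀ hθ₀ Ω _ P _ W V ξ X Y h
    refine ⟨fun K hK => ?_, fun δ hδ _ T hT => ?_⟩
    · obtain ⟨h1, h2⟩ := main θ₀ hθ₀ Ω P W V ξ X Y h K hK
      refine ⟨h1, h2.trans ?_⟩
      gcongr
      linarith
    · have hTδ : 1 ≤ T ^ δ := Real.one_le_rpow hT (by linarith)
      have hfl : 1 ≤ ⌊T ^ δ⌋₊ := Nat.one_le_floor_iff _ |>.2 hTδ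
      obtain ⟨-, h2⟩ := main θ₀ hθ₀ Ω P W V ξ X Y h _ hfl
      refine h2.trans ?_
      have hfl' : (1 : ℝ) ≤ (⌊T ^ δ⌋₊ : ℝ) := by exact_mod_cast hfl
      have hlt := Nat.lt_floor_add_one (T ^ δ)
      rw [Real.rpow_neg (by linarith), ← div_eq_mul_inv, div_le_div_iff₀ (by linarith)
        (by linarith)]
      -- From `1 ≤ ⌊T ^ δ⌋₊` it follows that `T ^ δ < ⌊T ^ δ⌋₊ + 1 ≤ 2 ⌊T ^ δ⌋₊`.
      nlinarith
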